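/- Let $G$ be a finite connected plane graph (no loops, no multiple edges) with no vertex of degree one inside a bounded face. Let $n\ge 1$, and let $B=v_0v_1\cdots v_{2n}$ be a path on the boundary of the unbounded face of $G$ such that $v_0$ and $v_{2n}$ are leaves of $G$ and each of $v_2,v_4,\dots,v_{2n-2}$ has degree $2$ in $G$. (Equivalently, $G$ arises from a plane graph $G_0$ with a path $v_1\cdots v_{2n-1}$ on the boundary of its unbounded face, where $v_2,v_4,\dots,v_{2n-2}$ have degree $2$, by attaching a leaf $v_0$ to $v_1$ and a leaf $v_{2n}$ to $v_{2n-1}$, both drawn in the unbounded face.) The dual refinement $H_G$ is the graph whose vertices are the vertices of $G$ (original vertices), the bounded faces of $G$ (face-vertices) and the edges of $G$ (edge-vertices), where the edge-vertex of $e$ is adjacent to the two endpoints of $e$ and to each bounded face whose boundary contains $e$; there are no other edges. Let $m_k$ be the edge-vertex of the edge $v_{k-1}v_k$, $1\le k\le 2n$. Let $G^+$ be obtained from $H_G$ by deleting $v_0,v_2,\dots,v_{2n}$ and $m_1,m_3,\dots,m_{2n-1}$, and let $G^-$ be obtained from $H_G$ by deleting $v_0,v_2,\dots,v_{2n}$ and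 $m_2,m_4,\dots,m_{2n}$. Then there is a natural bijection $\phi$ from the set of perfect matchings of $G^+$ to the set of perfect matchings of $G^-$, in the following sense: for every perfect matching $\mu$ of $G^+$ there are $n$ pairwise vertex-disjoint paths in $H_G\setminus\{v_0,v_2,\dots,v_{2n}\}$, each visiting either no face-vertex or no original vertex, which connect $m_1,m_3,\dots,m_{2n-1}$ in some order to $m_2,m_4,\dots,m_{2n}$, such that $\phi(\mu)$ is the symmetric difference of $\mu$ and the set of edges of these paths. In particular, the numbers $\operatorname{M}(G^+)$ and $\operatorname{M}(G^-)$ of perfect matchings of $G^+$ and $G^-$ are equal. -/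

import Mathlib

open scoped symmDiff

/-- A connected plane graph (with at least one edge) up to homeomorphism of the plane, given by its
combinatorial embedding: a connected simple graph on the (finite) vertex set `V`, the clockwise
cyclic order `rot` of the darts (oriented edges) leaving each vertex, and a distinguished outer
face. The orbits of the face permutation `d ↦ rot d.symm` (arrive along `d`, then take the leftmost
turn) are the faces, and the embedding is one in the sphere (equivalently, in the plane once a face
is chosen to contain the point at infinity) precisely when `|V| - |E| + |F| = 2`. -/
structure PlaneGraph (V : Type*) where
  /-- the underlying graph: no loops, no multiple edges -/
  graph : SimpleGraph V
  connected : graph.Connected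
  /-- the next dart, in clockwise order, leaving the same vertex -/
  rot : Equiv.Perm graph.Dart
  rot_fst : ∀ d, (rot d).fst = d.fst
  /-- the darts leaving a vertex form a single cycle of `rot` -/
  rot_cyclic : ∀ d d' : graph.Dart, d.fst = d'.fst → rot.SameCycle d d'
  /-- the embedding has genus zero -/
  genus_zero : Nat.card V +
      Nat.card (Quotient (Equiv.Perm.SameCycle.setoid
        ((SimpleGraph.Dart.symm_involutive (G := graph)).toPerm.trans rot))) =
    Nat.card graph.edgeSet + 2
  /-- the unbounded face -/
  outer : Quotient (Equiv.Perm.SameCycle.setoid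
        ((SimpleGraph.Dart.symm_involutive (G := graph)).toPerm.trans rot))

namespace PlaneGraph

variable {V : Type*} (G : PlaneGraph V)

/-- The face permutation: `d ↦ rot d.symm`. -/
def facePerm : Equiv.Perm G.graph.Dart :=
  (SimpleGraph.Dart.symm_involutive (G := G.graph)).toPerm.trans G.rot

/-- The faces: the orbits of the face permutation. -/
def Face : Type _ := Quotient (Equiv.Perm.SameCycle.setoid G.facePerm)

/-- The unbounded face. -/
def outerFace : G.Face := G.outer

/-- The face lying to the left of a dart. -/
def leftFace (d : G.graph.Dart) : G.Face :=
  Quotient.mk (Equiv.Perm.SameCycle.setoid G.facePerm) d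

/-- The edge `e` lies on the boundary of the face `f`. -/
def EdgeOnFace (e : Sym2 V) (f : G.Face) : Prop :=
  ∃ d : G.graph.Dart, d.edge = e ∧ G.leftFace d = f

/-- The degree of a vertex. -/
noncomputable def deg (v : V) : ℕ := (G.graph.neighborSet v).ncard

/-- No vertex of degree one lies inside a bounded face, i.e. every edge incident to a vertex of
degree one lies on the unbounded face. -/
def NoInnerLeaf : Prop :=
  ∀ v w : V, G.graph.Adj v w → G.deg v = 1 → G.EdgeOnFace s(v, w) G.outerFace

/-- The vertices of the dual refinement: the original vertices, the edge-vertices (midpoints of the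
edges of `G`) and the face-vertices (one for each bounded face of `G`). -/
inductive HVertex where
  | orig (v : V)
  | edge (e : G.graph.edgeSet)
  | face (f : {f : G.Face // f ≠ G.outerFace})

/-- The incidences of an edge-vertex: the two endpoints of the edge, and the bounded faces whose
boundary contains the edge. -/
def Incident : G.HVertex → G.HVertex → Prop
  | .edge e, .orig v => v ∈ (e : Sym2 V)
  | .edge e, .face f => G.EdgeOnFace e f
  | _, _ => False

/-- The dual refinement `H_G`. -/
def dualRefinement : SimpleGraph G.HVertex := SimpleGraph.fromRel G.Incident

/-- A path `v₀ v₁ ⋯ v₂ₙ` on the boundary of the unbounded face. -/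
structure BoundaryPath (n : ℕ) where
  vert : Fin (2 * n + 1) → V
  injective : Function.Injective vert
  adj : ∀ k : Fin (2 * n), G.graph.Adj (vert k.castSucc) (vert k.succ)
  on_outer : ∀ k : Fin (2 * n), G.EdgeOnFace s(vert k.castSucc, vert k.succ) G.outerFace

namespace BoundaryPath

variable {G} {n : ℕ} (B : G.BoundaryPath n)

/-- The edge-vertex of the `k`-th edge `v_k v_{k+1}` of the path, for `0 ≤ k < 2n`. It is the
neighbor of `v_k` towards the right, and of `v_{k+1}` towards the left, on the path. -/
def mid (k : Fin (2 * n)) : G.HVertex := .edge ⟨s(B.vert k.castSucc, B.vert k.succ), B.adj k⟩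

/-- The original vertices `v₀, v₂, …, v₂ₙ`. -/
def evenVertices : Set G.HVertex :=
  {x | ∃ k : Fin (2 * n + 1), Even (k : ℕ) ∧ x = .orig (B.vert k)}

/-- `G⁺`: remove from `H_G` the vertices `v₀, v₂, …, v₂ₙ`, and the nearest neighbors towards the
right of `v₀, v₂, …, v₂ₙ₋₂`. -/
def plus : SimpleGraph
    ↥(B.evenVertices ∪ {x | ∃ k : Fin (2 * n), Even (k : ℕ) ∧ x = B.mid k})ᶜ :=
  G.dualRefinement.induce _

/-- `G⁻`: remove from `H_G` the vertices `v₀, v₂, …, v₂ₙ`, and the nearest neighbors towards the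
left of `v₂, v₄, …, v₂ₙ`. -/
def minus : SimpleGraph
    ↥(B.evenVertices ∪ {x | ∃ k : Fin (2 * n), Odd (k : ℕ) ∧ x = B.mid k})ᶜ :=
  G.dualRefinement.induce _

end BoundaryPath

end PlaneGraph

/-- The set of perfect matchings of a graph. -/
def PerfectMatchings {W : Type*} (H : SimpleGraph W) : Type _ :=
  {M : H.Subgraph // M.IsPerfectMatching}

/-- `M(H)`, the number of perfect matchings of a (finite) graph. -/
noncomputable def numPerfectMatchings {W : Type*} (H : SimpleGraph W) : ℕ :=
  Nat.card (PerfectMatchings H)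

namespace PlaneGraph

variable {V : Type*} {G : PlaneGraph V}

/-- The edges of a perfect matching of an induced subgraph of `H_G`, as a set of edges of `H_G`. -/
def matchingEdges {S : Set G.HVertex} {H : SimpleGraph S} (μ : PerfectMatchings H) :
    Set (Sym2 G.HVertex) :=
  Sym2.map Subtype.val '' μ.1.edgeSet

/-- The walk stays on the frame (the union of the edges of `G`): it visits no face-vertex. -/
def OnFrame {x y : G.HVertex} (P : G.dualRefinement.Walk x y) : Prop :=
  ∀ f, HVertex.face f ∉ P.support

/-- The walk stays on the dual frame (the union of the edges of the planar dual, including the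
segments from face-vertices to edge-vertices on the unbounded face): it visits no original
vertex. -/
def OnDualFrame {x y : G.HVertex} (P : G.dualRefinement.Walk x y) : Prop :=
  ∀ v, HVertex.orig v ∉ P.support

/-- `μ'` arises from `μ` by shifting along a family of `n` non-intersecting paths on
`H_G ∖ {v₀, v₂, …, v₂ₙ}`, each of them contained in the frame or in the dual frame, which connect
the `n` edge-vertices of the path removed in `G⁺` to the `n` edge-vertices of the path removed in
`G⁻`: the edges of the paths that are in `μ` are discarded, those that are not in `μ` are included,
and all other edges of `μ` are kept. -/
def BoundaryPath.IsShift {n : ℕ} (B : G.BoundaryPath n)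
    (μ : PerfectMatchings B.plus) (μ' : PerfectMatchings B.minus) : Prop :=
  ∃ (τ : Equiv.Perm (Fin n))
    (P : ∀ i : Fin n, G.dualRefinement.Walk
      (B.mid ⟨2 * i, by omega⟩) (B.mid ⟨2 * τ i + 1, by omega⟩)),
    (∀ i, (P i).IsPath) ∧
    (∀ i, ∀ x ∈ (P i).support, x ∉ B.evenVertices) ∧
    (∀ i, OnFrame (P i) ∨ OnDualFrame (P i)) ∧
    (∀ i j, i ≠ j → ∀ x ∈ (P i).support, x ∉ (P j).support) ∧
    matchingEdges μ' = matchingEdges μ ∆ {e | ∃ i, e ∈ (P i).edges}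

end PlaneGraph

/-!
A perfect matching `μ` of `G⁺` is read as a system of arrows: an original vertex points along the
edge matched to it to the other endpoint, and a bounded face points across the edge matched to it to
the face on the other side (`BoundaryPath.Step`). The arrows fall into connected classes. For each
`k`, exactly one arrow leaves along `v₂ₖ₊₁ v₂ₖ₊₂`, either from `v₂ₖ₊₁` to the deleted vertex `v₂ₖ₊₂`
or from the face next to this edge to the unbounded face; call its tail an end. A class contains at
most one end, and the ends lie in `n` distinct classes, none of which is that of the unbounded face.

A path from the deleted edge-vertex of `v₂ᵢ v₂ᵢ₊₁` that exchanges the edges of `μ` for others has to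
start at `v₂ᵢ₊₁` or at the face next to this edge, and then to follow the arrows to an end. So a
shift of `μ` amounts to choosing, for each `i`, one of these two neighbors, in such a way that the
paths from them lead to different ends. Regard each `i` as a link between the classes of the two
neighbors. If the links connect the `n` classes with an end to the class of the unbounded face, then
they form a tree on these `n + 1` classes, and there is exactly one choice, which orients the tree
away from the unbounded face (`existsUnique_perm_of_connected`).

The links do connect these classes (`BoundaryPath.EvenDegrees.notMem_of_invariant`): a union of
classes that is closed under the links and avoids the unbounded face consists of vertices `K` and
faces `L`, and the boundary of `L` is a circulation. Away from the path it does not cross between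
`K` and its complement, so the flow along the path balances, which excludes all vertices and faces
at the path. For this the faces next to the path must be counted with a sign, according to
the side of the path on which they lie. That these signs agree on adjacent bounded faces
(`BoundaryPath.not_reflTransGen_boundedAdj`) is where planarity enters, in the form that every
closed form on the darts has a potential (`PlaneGraph.exists_potential`), a dimension count based on
Euler's formula.

So every perfect matching of `G⁺` has exactly one shift. As reversing the path exchanges `G⁺` with
`G⁻`, every perfect matching of `G⁻` is the shift of exactly one perfect matching of `G⁺`.
-/

/-! ### Faces and orthogonality -/

namespace PlaneGraph

variable {V : Type*} (G : PlaneGraph V)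

instance [Finite V] : Finite G.graph.Dart :=
  Finite.of_injective (fun d => d.toProd) SimpleGraph.Dart.toProd_injective

instance [Finite V] : Finite G.Face := by
  unfold Face
  infer_instance

theorem facePerm_apply (d : G.graph.Dart) : G.facePerm d = G.rot d.symm := rfl

theorem leftFace_facePerm (d : G.graph.Dart) : G.leftFace (G.facePerm d) = G.leftFace d :=
  Quotient.sound (s := Equiv.Perm.SameCycle.setoid G.facePerm)
    (Equiv.Perm.sameCycle_apply_left.2 (Equiv.Perm.SameCycle.refl _ _))

theorem leftFace_rot (d : G.graph.Dart) : G.leftFace (G.rot d) = G.leftFace d.symm := by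
  rw [← leftFace_facePerm G d.symm, facePerm_apply, SimpleGraph.Dart.symm_symm]

theorem leftFace_surjective : Function.Surjective G.leftFace := Quotient.mk_surjective

variable {G}

theorem edgeOnFace_iff (d : G.graph.Dart) (f : G.Face) :
    G.EdgeOnFace d.edge f ↔ f = G.leftFace d ∨ f = G.leftFace d.symm := by
  constructor
  · rintro ⟨d', hd', rfl⟩
    rcases (SimpleGraph.dart_edge_eq_iff d' d).1 hd' with rfl | rfl
    · exact Or.inl rfl
    · exact Or.inr rfl
  · rintro (rfl | rfl)
    · exact ⟨d, rfl, rfl⟩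
    · exact ⟨d.symm, d.edge_symm, rfl⟩

/-- The coboundary of a function on vertices is orthogonal to the boundary of a chain of faces:
around each vertex, every face enters as often as it leaves. -/
theorem sum_mul_leftFace_sub [Fintype G.graph.Dart] (h : V → ℚ) (s : G.Face → ℚ) :
    ∑ d : G.graph.Dart, h d.fst * (s (G.leftFace d) - s (G.leftFace d.symm)) = 0 := by
  have key : ∑ d : G.graph.Dart, h d.fst * s (G.leftFace d.symm) =
      ∑ d : G.graph.Dart, h d.fst * s (G.leftFace d) := by
    rw [eq_comm, ← Equiv.sum_comp G.rot]
    exact Finset.sum_congr rfl fun d _ => by rw [G.rot_fst, leftFace_rot]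
  simp [mul_sub, Finset.sum_sub_distrib, key]

theorem sum_comp_symm [Fintype G.graph.Dart] (u : G.graph.Dart → ℚ) :
    ∑ d : G.graph.Dart, u d.symm = ∑ d, u d :=
  Equiv.sum_comp (SimpleGraph.Dart.symm_involutive (G := G.graph)).toPerm u

theorem sum_sub_mul_leftFace_sub [Fintype G.graph.Dart] (h : V → ℚ) (s : G.Face → ℚ) :
    ∑ d : G.graph.Dart, (h d.fst - h d.snd) * (s (G.leftFace d) - s (G.leftFace d.symm)) = 0 := by
  have h1 := sum_mul_leftFace_sub (G := G) h s
  have h2 : ∑ d : G.graph.Dart, h d.snd * (s (G.leftFace d) - s (G.leftFace d.symm)) = 0 := by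
    rw [← sum_comp_symm]
    have : ∀ d : G.graph.Dart, h d.symm.snd *
        (s (G.leftFace d.symm) - s (G.leftFace d.symm.symm)) =
        -(h d.fst * (s (G.leftFace d) - s (G.leftFace d.symm))) := by
      intro d
      rw [SimpleGraph.Dart.symm_symm]
      change h d.fst * _ = _
      ring
    simp only [this, Finset.sum_neg_distrib, h1, neg_zero]
  simp only [sub_mul, Finset.sum_sub_distrib, h1, h2, sub_zero]

theorem eq_of_adj_eq {α : Type*} {h : V → α} (hh : ∀ d : G.graph.Dart, h d.fst = h d.snd)
    (v w : V) : h v = h w := by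
  obtain ⟨p⟩ := G.connected.preconnected v w
  induction p with
  | nil => rfl
  | cons hadj _ ih => exact (hh ⟨(_, _), hadj⟩).trans ih

/-- The dual graph is connected. -/
theorem eq_of_leftFace_eq [Finite V] {α : Type*} {s : G.Face → α}
    (hs : ∀ d : G.graph.Dart, s (G.leftFace d) = s (G.leftFace d.symm)) (f g : G.Face) :
    s f = s g := by
  have hrot : ∀ d d' : G.graph.Dart, d.fst = d'.fst → s (G.leftFace d) = s (G.leftFace d') := by
    intro d d' hdd
    obtain ⟨k, rfl⟩ := (G.rot_cyclic d d' hdd).exists_nat_pow_eq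
    induction k with
    | zero => rfl
    | succ k ih =>
      rw [pow_succ', Equiv.Perm.mul_apply, leftFace_rot, ← hs]
      refine ih ?_
      clear ih hdd
      induction k with
      | zero => rfl
      | succ k ih => rw [pow_succ', Equiv.Perm.mul_apply, G.rot_fst, ← ih]
  have hwalk : ∀ {v w : V} (_ : G.graph.Walk v w) (d d' : G.graph.Dart), d.fst = v → d'.fst = w →
      s (G.leftFace d) = s (G.leftFace d') := by
    intro v w p
    induction p with
    | nil => exact fun d d' h h' => hrot d d' (h.trans h'.symm)
    | @cons u v w hadj p ih =>
      intro d d' h h'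
      let c : G.graph.Dart := ⟨(u, v), hadj⟩
      rw [hrot d c h, hs c]
      exact ih c.symm d' rfl h'
  obtain ⟨d, rfl⟩ := G.leftFace_surjective f
  obtain ⟨d', rfl⟩ := G.leftFace_surjective g
  obtain ⟨p⟩ := G.connected.preconnected d.fst d'.fst
  exact hwalk p d d' rfl rfl

/-- The sum of an edge function, a coboundary and a boundary of a chain of faces. -/
def decompose (G : PlaneGraph V) :
    ((G.graph.edgeSet → ℚ) × (V → ℚ) × (G.Face → ℚ)) →ₗ[ℚ] (G.graph.Dart → ℚ) where
  toFun x d := x.1 ⟨d.edge, d.edge_mem⟩ + (x.2.1 d.fst - x.2.1 d.snd) +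
    (x.2.2 (G.leftFace d) - x.2.2 (G.leftFace d.symm))
  map_add' x y := by
    funext d
    simp only [Prod.fst_add, Prod.snd_add, Pi.add_apply]
    ring
  map_smul' c x := by
    funext d
    simp only [Prod.smul_fst, Prod.smul_snd, Pi.smul_apply, smul_eq_mul, RingHom.id_apply]
    ring

theorem decompose_apply (u : G.graph.edgeSet → ℚ) (h : V → ℚ) (s : G.Face → ℚ)
    (d : G.graph.Dart) : G.decompose (u, h, s) d =
      u ⟨d.edge, d.edge_mem⟩ + (h d.fst - h d.snd) +
        (s (G.leftFace d) - s (G.leftFace d.symm)) := rfl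

/-- The edge function is the symmetric part of the sum, so it vanishes if the sum is
antisymmetric. -/
theorem edge_eq_zero_of_decompose_eq {u : G.graph.edgeSet → ℚ} {h : V → ℚ} {s : G.Face → ℚ}
    {θ : G.graph.Dart → ℚ} (hθ : ∀ d, θ d.symm = -θ d) (hd : G.decompose (u, h, s) = θ)
    (d : G.graph.Dart) : u ⟨d.edge, d.edge_mem⟩ = 0 := by
  have h1 := congrFun hd d
  have h2 := congrFun hd d.symm
  have h3 : (⟨d.symm.edge, d.symm.edge_mem⟩ : G.graph.edgeSet) = ⟨d.edge, d.edge_mem⟩ :=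
    Subtype.ext d.edge_symm
  rw [decompose_apply] at h1 h2
  rw [h3, SimpleGraph.Dart.symm_symm, hθ] at h2
  change _ + (h d.snd - h d.fst) + _ = _ at h2
  linarith

theorem exists_dart_edge (e : G.graph.edgeSet) :
    ∃ d : G.graph.Dart, (⟨d.edge, d.edge_mem⟩ : G.graph.edgeSet) = e := by
  obtain ⟨e, he⟩ := e
  induction e with
  | _ v w => exact ⟨⟨(v, w), he⟩, rfl⟩

/-- A coboundary plus a boundary vanishes only if both summands do. -/
theorem eq_of_sum_eq_zero [Finite V] {h : V → ℚ} {s : G.Face → ℚ}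
    (H : ∀ d : G.graph.Dart, (h d.fst - h d.snd) + (s (G.leftFace d) - s (G.leftFace d.symm)) = 0)
    (d : G.graph.Dart) : h d.fst = h d.snd := by
  have := Fintype.ofFinite G.graph.Dart
  have h0 : ∑ d : G.graph.Dart, (h d.fst - h d.snd) * (h d.fst - h d.snd) = 0 := by
    rw [← neg_eq_zero, ← Finset.sum_neg_distrib, ← sum_sub_mul_leftFace_sub (G := G) h s]
    refine Finset.sum_congr rfl fun d _ => ?_
    linear_combination (-(h d.fst - h d.snd)) * H d
  have h1 := (Finset.sum_eq_zero_iff_of_nonneg fun d _ => mul_self_nonneg _).1 h0 d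
    (Finset.mem_univ d)
  exact sub_eq_zero.1 (mul_self_eq_zero.1 h1)

/-- Genus zero makes every function on darts the sum of an edge function, a coboundary and a
boundary: the kernel of `decompose` is two-dimensional, and Euler's formula gives the rest. -/
theorem decompose_surjective [Finite V] : Function.Surjective G.decompose := by
  classical
  have := Fintype.ofFinite V
  have := Fintype.ofFinite G.Face
  have := Fintype.ofFinite G.graph.Dart
  obtain ⟨v₀⟩ := G.connected.nonempty
  have hker : Module.finrank ℚ (LinearMap.ker G.decompose) ≤ 2 := by
    let ev : LinearMap.ker G.decompose →ₗ[ℚ] ℚ × ℚ :=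
      { toFun := fun x => (x.1.2.1 v₀, x.1.2.2 G.outerFace)
        map_add' := fun _ _ => rfl
        map_smul' := fun _ _ => rfl }
    have hinj : Function.Injective ev := by
      rw [← LinearMap.ker_eq_bot, LinearMap.ker_eq_bot']
      rintro ⟨⟨u, h, s⟩, hx⟩ hev
      have h1 : h v₀ = 0 := congrArg Prod.fst hev
      have h2 : s G.outerFace = 0 := congrArg Prod.snd hev
      have hx' : G.decompose (u, h, s) = 0 := hx
      have hu := edge_eq_zero_of_decompose_eq (θ := 0) (fun d => by simp) hx'
      have H : ∀ d : G.graph.Dart,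
          (h d.fst - h d.snd) + (s (G.leftFace d) - s (G.leftFace d.symm)) = 0 := by
        intro d
        have := congrFun hx' d
        rw [decompose_apply, hu, zero_add] at this
        exact this
      have hh := eq_of_sum_eq_zero H
      have hs : ∀ d : G.graph.Dart, s (G.leftFace d) = s (G.leftFace d.symm) := by
        intro d
        have := H d
        rw [hh d, sub_self, zero_add] at this
        exact sub_eq_zero.1 this
      have hu0 : u = 0 := by
        funext e
        obtain ⟨d, rfl⟩ := exists_dart_edge e
        exact hu d
      have hh0 : h = 0 := funext fun v => (eq_of_adj_eq hh v v₀).trans h1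
      have hs0 : s = 0 := funext fun f => (eq_of_leftFace_eq hs f G.outerFace).trans h2
      subst hu0 hh0 hs0
      rfl
    have := LinearMap.finrank_le_finrank_of_injective hinj
    simpa using this
  have hrn := LinearMap.finrank_range_add_finrank_ker G.decompose
  have hdom : Module.finrank ℚ ((G.graph.edgeSet → ℚ) × (V → ℚ) × (G.Face → ℚ)) =
      Nat.card G.graph.edgeSet + (Nat.card V + Nat.card G.Face) := by
    simp [Module.finrank_prod, Nat.card_eq_fintype_card]
  have hcod : Module.finrank ℚ (G.graph.Dart → ℚ) = 2 * Nat.card G.graph.edgeSet := by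
    rw [Module.finrank_fintype_fun_eq_card, Nat.card_eq_fintype_card,
      ← SimpleGraph.edgeFinset_card]
    convert G.graph.dart_card_eq_twice_card_edges
  have hgenus : Nat.card V + Nat.card G.Face = Nat.card G.graph.edgeSet + 2 := G.genus_zero
  rw [← LinearMap.range_eq_top]
  apply Submodule.eq_top_of_finrank_eq
  apply le_antisymm (Submodule.finrank_le _)
  omega

/-- On a plane graph every closed form is exact. -/
theorem exists_potential [Finite V] [Fintype G.graph.Dart] {θ : G.graph.Dart → ℚ}
    (hθ : ∀ d, θ d.symm = -θ d) (hc : ∀ s : G.Face → ℚ, ∑ d, θ d * s (G.leftFace d) = 0) :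
    ∃ h : V → ℚ, ∀ d, θ d = h d.fst - h d.snd := by
  obtain ⟨⟨u, h, s⟩, hx⟩ := G.decompose_surjective θ
  refine ⟨h, ?_⟩
  have hu := edge_eq_zero_of_decompose_eq hθ hx
  have hθ' : ∀ d, θ d = (h d.fst - h d.snd) + (s (G.leftFace d) - s (G.leftFace d.symm)) := by
    intro d
    rw [← hx, decompose_apply, hu, zero_add]
  have hz : ∑ d, (s (G.leftFace d) - s (G.leftFace d.symm)) *
      (s (G.leftFace d) - s (G.leftFace d.symm)) = 0 := by
    have h1 : ∑ d, θ d * s (G.leftFace d.symm) = 0 := by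
      rw [← sum_comp_symm, ← neg_eq_zero, ← Finset.sum_neg_distrib, ← hc s]
      refine Finset.sum_congr rfl fun d _ => ?_
      rw [hθ, SimpleGraph.Dart.symm_symm]
      ring
    have h2 := sum_sub_mul_leftFace_sub (G := G) h s
    calc _ = ∑ d, (θ d * s (G.leftFace d) - θ d * s (G.leftFace d.symm) -
          (h d.fst - h d.snd) * (s (G.leftFace d) - s (G.leftFace d.symm))) := by
          refine Finset.sum_congr rfl fun d _ => ?_
          rw [hθ']
          ring
      _ = 0 := by
          rw [Finset.sum_sub_distrib, Finset.sum_sub_distrib, hc s, h1, h2]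
          ring
  intro d
  have h1 := (Finset.sum_eq_zero_iff_of_nonneg fun d _ => mul_self_nonneg _).1 hz d
    (Finset.mem_univ d)
  rw [hθ' d, mul_self_eq_zero.1 h1, add_zero]

end PlaneGraph

/-! ### The two sides of the boundary path -/

namespace PlaneGraph

variable {V : Type*} {G : PlaneGraph V}

/-- The elementary form crossing the dart `a`. -/
def crossing [DecidableEq G.graph.Dart] (a d : G.graph.Dart) : ℚ :=
  (if d = a then 1 else 0) - (if d = a.symm then 1 else 0)

theorem crossing_symm [DecidableEq G.graph.Dart] (a d : G.graph.Dart) :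
    crossing a d.symm = -crossing a d := by
  have h1 : d.symm = a ↔ d = a.symm := by
    constructor <;> rintro rfl <;> simp
  have h2 : d.symm = a.symm ↔ d = a := by
    constructor
    · intro h
      simpa using congrArg SimpleGraph.Dart.symm h
    · rintro rfl
      rfl
  simp [crossing, h1, h2]

theorem sum_crossing [DecidableEq G.graph.Dart] [Fintype G.graph.Dart] (a : G.graph.Dart)
    (s : G.Face → ℚ) :
    ∑ d, crossing a d * s (G.leftFace d) = s (G.leftFace a) - s (G.leftFace a.symm) := by
  simp [crossing, sub_mul, Finset.sum_sub_distrib]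

/-- Two bounded faces share an edge. -/
def BoundedAdj (f g : G.Face) : Prop :=
  f ≠ G.outerFace ∧ g ≠ G.outerFace ∧ ∃ d : G.graph.Dart, G.leftFace d = f ∧ G.leftFace d.symm = g

/-- A dual walk through bounded faces gives a form that vanishes on the darts along the outer face
and has the ends of the walk as its only source and sink. -/
theorem exists_form_of_reflTransGen [Fintype G.graph.Dart] {f g : G.Face}
    (h : Relation.ReflTransGen BoundedAdj f g) :
    ∃ θ : G.graph.Dart → ℚ, (∀ d, θ d.symm = -θ d) ∧ (∀ d, G.leftFace d = G.outerFace → θ d = 0) ∧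
      ∀ s : G.Face → ℚ, ∑ d, θ d * s (G.leftFace d) = s f - s g := by
  classical
  induction h with
  | refl => exact ⟨0, by simp, by simp, by simp⟩
  | @tail f' g' _ hfg ih =>
    obtain ⟨θ, h1, h2, h3⟩ := ih
    obtain ⟨hf, hg, a, rfl, rfl⟩ := hfg
    refine ⟨fun d => θ d + crossing a d, fun d => ?_, fun d hd => ?_, fun s => ?_⟩
    · simp only [h1, crossing_symm]
      ring
    · have e1 : d ≠ a := by
        rintro rfl
        exact hf hd
      have e2 : d ≠ a.symm := by
        rintro rfl
        exact hg hd
      simp [h2 d hd, crossing, e1, e2]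
    · simp only [add_mul, Finset.sum_add_distrib, h3, sum_crossing]
      ring

theorem dart_ext {d d' : G.graph.Dart} (h1 : d.fst = d'.fst) (h2 : d.snd = d'.snd) :
    d = d' :=
  SimpleGraph.Dart.ext _ _ (Prod.ext h1 h2)

theorem eq_of_deg_one {d x : G.graph.Dart} (h : G.deg d.fst = 1) (hx : x.fst = d.fst) :
    x = d := by
  obtain ⟨w, hw⟩ := Set.ncard_eq_one.1 h
  have h1 : d.snd ∈ G.graph.neighborSet d.fst := d.adj
  have h2 : x.snd ∈ G.graph.neighborSet d.fst := hx ▸ x.adj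
  rw [hw] at h1 h2
  exact dart_ext hx (h2.trans h1.symm)

theorem leftFace_symm_of_deg_one {d : G.graph.Dart} (h : G.deg d.fst = 1) :
    G.leftFace d = G.leftFace d.symm := by
  rw [← leftFace_rot, eq_of_deg_one h (G.rot_fst d)]

theorem eq_or_eq_of_deg_two {d d' x : G.graph.Dart} (h : G.deg d.fst = 2) (hd : d'.fst = d.fst)
    (hne : d ≠ d') (hx : x.fst = d.fst) : x = d ∨ x = d' := by
  obtain ⟨p, q, -, hw⟩ := Set.ncard_eq_two.1 h
  have h1 : d.snd ∈ G.graph.neighborSet d.fst := d.adj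
  have h2 : d'.snd ∈ G.graph.neighborSet d.fst := hd ▸ d'.adj
  have h3 : x.snd ∈ G.graph.neighborSet d.fst := hx ▸ x.adj
  have h4 : d.snd ≠ d'.snd := fun h => hne (dart_ext hd.symm h)
  rw [hw] at h1 h2 h3
  have h5 : x.snd = d.snd ∨ x.snd = d'.snd := by
    rcases h1 with h1 | h1 <;> rcases h2 with h2 | h2 <;> rcases h3 with h3 | h3 <;>
      simp_all
  rcases h5 with h5 | h5
  · exact Or.inl (dart_ext hx h5)
  · exact Or.inr (dart_ext (hx.trans hd.symm) h5)

theorem leftFace_of_deg_two {d d' : G.graph.Dart} (h : G.deg d.fst = 2) (hd : d'.fst = d.fst)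
    (hne : d ≠ d') : G.leftFace d' = G.leftFace d.symm := by
  rw [← leftFace_rot]
  congr 1
  rcases eq_or_eq_of_deg_two h hd hne (G.rot_fst d) with h1 | h1
  · obtain ⟨k, hk⟩ := G.rot_cyclic d d' hd.symm
    refine absurd ?_ hne
    rw [← hk]
    exact (Equiv.Perm.zpow_apply_eq_self_of_apply_eq_self h1 k).symm
  · exact h1.symm

namespace BoundaryPath

variable {n : ℕ} (B : G.BoundaryPath n)

/-- The `k`-th step of the path. -/
def dart (k : Fin (2 * n)) : G.graph.Dart := ⟨(B.vert k.castSucc, B.vert k.succ), B.adj k⟩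

/-- The path has positive length, starts and ends in leaves, and its other even vertices have
degree two. -/
structure EvenDegrees : Prop where
  pos : 1 ≤ n
  first : G.deg (B.vert 0) = 1
  last : G.deg (B.vert (Fin.last (2 * n))) = 1
  even : ∀ k : Fin (2 * n + 1), Even (k : ℕ) → k ≠ 0 → k ≠ Fin.last (2 * n) → G.deg (B.vert k) = 2

theorem leftFace_dart_eq_outer_or (k : Fin (2 * n)) :
    G.leftFace (B.dart k) = G.outerFace ∨ G.leftFace (B.dart k).symm = G.outerFace := by
  have := (edgeOnFace_iff (B.dart k) G.outerFace).1 (B.on_outer k)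
  simpa [eq_comm] using this

theorem dart_ne_symm (i k : Fin (2 * n)) : B.dart i ≠ (B.dart k).symm := by
  intro h
  have h1 : B.vert i.castSucc = B.vert k.succ := congrArg (fun d => d.fst) h
  have h2 : B.vert i.succ = B.vert k.castSucc := congrArg (fun d => d.snd) h
  have h3 := congrArg Fin.val (B.injective h1)
  have h4 := congrArg Fin.val (B.injective h2)
  simp at h3 h4
  omega

theorem dart_injective : Function.Injective B.dart := by
  intro i k h
  have h1 : B.vert i.castSucc = B.vert k.castSucc := congrArg (fun d => d.fst) h
  exact Fin.castSucc_injective _ (B.injective h1)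

theorem dart_edge_injective : Function.Injective fun k => (B.dart k).edge := by
  intro i k h
  rcases (SimpleGraph.dart_edge_eq_iff _ _).1 h with h | h
  · exact B.dart_injective h
  · exact absurd h (B.dart_ne_symm i k)

/-- If the outer face lies to the right of one step of the path and to the left of another one, the
bounded faces on the other sides cannot be joined by a dual walk through bounded faces. Otherwise,
closing this walk up through the outer face would give a form with a potential that grows along the
path at both steps, whereas along the outer face it changes at two darts only. -/
theorem not_reflTransGen_boundedAdj [Finite V] {j j' : Fin (2 * n)}
    (hj : G.leftFace (B.dart j).symm = G.outerFace)
    (hj1 : G.leftFace (B.dart j) ≠ G.outerFace)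
    (hj' : G.leftFace (B.dart j') = G.outerFace)
    (hj'1 : G.leftFace (B.dart j').symm ≠ G.outerFace) :
    ¬ Relation.ReflTransGen BoundedAdj (G.leftFace (B.dart j)) (G.leftFace (B.dart j').symm) := by
  classical
  intro hr
  have := Fintype.ofFinite G.graph.Dart
  obtain ⟨θ₀, h1, h2, h3⟩ := exists_form_of_reflTransGen hr
  set a := (B.dart j).symm with ha
  set b := (B.dart j').symm with hb
  have hbs : b.symm = B.dart j' := by simp [hb]
  have has : a.symm = B.dart j := by simp [ha]
  obtain ⟨h, hh⟩ := exists_potential (G := G) (θ := fun d => crossing a d + θ₀ d + crossing b d)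
    (fun d => by
      simp only [crossing_symm, h1]
      ring)
    (fun s => by
      simp only [add_mul, Finset.sum_add_distrib, sum_crossing, h3, has, hbs, hj, hj']
      ring)
  have hstep : ∀ i : Fin (2 * n), h (B.vert i.castSucc) - h (B.vert i.succ) =
      -(if i = j then 1 else 0) - (if i = j' then 1 else 0) := by
    intro i
    have e0 : θ₀ (B.dart i) = 0 := by
      rcases B.leftFace_dart_eq_outer_or i with hi | hi
      · exact h2 _ hi
      · rw [← neg_eq_zero, ← h1]
        exact h2 _ hi
    refine (hh (B.dart i)).symm.trans ?_
    simp only [crossing, e0, ha, hb, SimpleGraph.Dart.symm_symm, B.dart_ne_symm,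
      B.dart_injective.eq_iff, if_false]
    ring
  have hmono : Monotone fun i => h (B.vert i) := by
    refine Fin.monotone_iff_le_succ.2 fun i => ?_
    have := hstep i
    split_ifs at this <;> linarith
  have hjj : j ≠ j' := by
    rintro rfl
    exact hj1 hj'
  have hjs := hstep j
  rw [if_pos rfl, if_neg hjj] at hjs
  -- the level set, which the face permutation enters at `a` but never leaves
  let W : Set G.graph.Dart :=
    {d | G.leftFace d = G.outerFace ∧ h d.fst < h (B.vert j.succ)}
  have hsnd : ∀ d, (G.facePerm d).fst = d.snd := fun d => by
    rw [facePerm_apply, G.rot_fst]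
    rfl
  have hW : Set.MapsTo G.facePerm W W := by
    rintro d ⟨hd, hlt⟩
    refine ⟨by rw [leftFace_facePerm, hd], ?_⟩
    rw [hsnd]
    have hd' := hh d
    have e0 := h2 d hd
    have e1 : d ≠ a := by
      rintro rfl
      exact lt_irrefl _ hlt
    have e2 : d ≠ a.symm := by
      rintro rfl
      exact hj1 (has ▸ hd)
    have e3 : d ≠ b := by
      rintro rfl
      exact hj'1 hd
    by_cases e4 : d = b.symm
    · rw [hbs] at e4
      subst e4
      change h (B.vert j'.succ) < _
      change h (B.vert j'.castSucc) < _ at hlt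
      have h5 : j' < j := by
        by_contra h5
        have h6 : j.succ ≤ j'.castSucc := by
          rw [Fin.le_def]
          simp
          have : j.val ≠ j'.val := fun h => hjj (Fin.ext h)
          have : j.val ≤ j'.val := not_lt.1 h5
          omega
        exact absurd (hmono h6) (not_le.2 hlt)
      have h6 : j'.succ ≤ j.castSucc := by
        rw [Fin.le_def]
        simpa using h5
      have := hmono h6
      simp only at this
      linarith
    · simp only [crossing, e0, e1, e2, e3, e4, if_false] at hd'
      linarith
  have hfin : Finite W := inferInstance
  have haW : G.facePerm a ∈ W := by
    refine ⟨by rw [leftFace_facePerm, hj], ?_⟩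
    rw [hsnd]
    change h (B.vert j.castSucc) < _
    linarith
  have := Equiv.Perm.perm_symm_mapsTo_of_mapsTo G.facePerm hW haW
  rw [Equiv.symm_apply_apply] at this
  exact lt_irrefl _ this.2

open Classical in
/-- The face opposite to the outer face along an edge of the path (the outer face itself if it lies
on both sides). -/
noncomputable def innerFace (k : Fin (2 * n)) : G.Face :=
  if G.leftFace (B.dart k) = G.outerFace then G.leftFace (B.dart k).symm else G.leftFace (B.dart k)

theorem edgeOnFace_dart_iff (k : Fin (2 * n)) (f : G.Face) :
    G.EdgeOnFace (B.dart k).edge f ↔ f = G.outerFace ∨ f = B.innerFace k := by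
  rw [edgeOnFace_iff, innerFace]
  split_ifs with h
  · rw [h]
  · rcases B.leftFace_dart_eq_outer_or k with h' | h'
    · exact absurd h' h
    · rw [h', or_comm]

variable {B}

namespace EvenDegrees

variable (hB : B.EvenDegrees)
include hB

theorem innerFace_first (h : 0 < 2 * n) : B.innerFace ⟨0, h⟩ = G.outerFace := by
  have h1 : G.leftFace (B.dart ⟨0, h⟩) = G.leftFace (B.dart ⟨0, h⟩).symm :=
    leftFace_symm_of_deg_one hB.first
  rcases B.leftFace_dart_eq_outer_or ⟨0, h⟩ with h2 | h2 <;> simp_all [innerFace]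

theorem leftFace_last (h : 2 * n - 1 < 2 * n) : G.leftFace (B.dart ⟨2 * n - 1, h⟩) =
    G.leftFace (B.dart ⟨2 * n - 1, h⟩).symm := by
  have h0 : (⟨2 * n - 1, h⟩ : Fin (2 * n)).succ = Fin.last (2 * n) := by
    ext
    simp
    omega
  have h1 : G.deg (B.dart ⟨2 * n - 1, h⟩).symm.fst = 1 := by
    change G.deg (B.vert (⟨2 * n - 1, h⟩ : Fin (2 * n)).succ) = 1
    rw [h0, hB.last]
  simpa using (leftFace_symm_of_deg_one h1).symm

theorem deg_dart {i : ℕ} (h : 2 * i + 2 < 2 * n) :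
    G.deg (B.dart ⟨2 * i + 2, h⟩).fst = 2 := by
  refine hB.even _ ?_ ?_ ?_
  · exact ⟨i + 1, by simp; ring⟩
  · intro h'
    simpa using congrArg Fin.val h'
  · intro h'
    have := congrArg Fin.val h'
    simp at this
    omega

theorem leftFace_eq {i : ℕ} (h : 2 * i + 2 < 2 * n) :
    G.leftFace (B.dart ⟨2 * i + 2, h⟩) = G.leftFace (B.dart ⟨2 * i + 1, by omega⟩) := by
  have := leftFace_of_deg_two (d := (B.dart ⟨2 * i + 1, by omega⟩).symm)
    (d' := B.dart ⟨2 * i + 2, h⟩) (hB.deg_dart h) rfl (B.dart_ne_symm _ _).symm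
  simpa using this

theorem leftFace_symm_eq {i : ℕ} (h : 2 * i + 2 < 2 * n) :
    G.leftFace (B.dart ⟨2 * i + 2, h⟩).symm =
      G.leftFace (B.dart ⟨2 * i + 1, by omega⟩).symm :=
  (leftFace_of_deg_two (d' := (B.dart ⟨2 * i + 1, by omega⟩).symm)
    (d := B.dart ⟨2 * i + 2, h⟩) (hB.deg_dart h) rfl (B.dart_ne_symm _ _)).symm

theorem innerFace_eq {i : ℕ} (h : 2 * i + 2 < 2 * n) :
    B.innerFace ⟨2 * i + 2, h⟩ = B.innerFace ⟨2 * i + 1, by omega⟩ := by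
  rw [innerFace, innerFace, hB.leftFace_eq h, hB.leftFace_symm_eq h]

theorem innerFace_last (h : 2 * n - 1 < 2 * n) : B.innerFace ⟨2 * n - 1, h⟩ = G.outerFace := by
  have h1 := hB.leftFace_last h
  rcases B.leftFace_dart_eq_outer_or ⟨2 * n - 1, h⟩ with h2 | h2 <;> simp_all [innerFace]

/-- The only edges at the even vertices are those of the path. -/
theorem exists_edge_eq (d : G.graph.Dart) (k : Fin (2 * n + 1)) (hk : Even (k : ℕ))
    (hd : d.fst = B.vert k) : ∃ j, d.edge = (B.dart j).edge := by
  have hn := hB.pos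
  obtain ⟨m, hm⟩ := hk
  have hk2 := k.2
  rcases Nat.eq_zero_or_pos m with h0 | h0
  · obtain rfl : k = 0 := by
      ext
      rw [Fin.val_zero]
      omega
    have hd0 : d = B.dart ⟨0, by omega⟩ := eq_of_deg_one (d := B.dart ⟨0, by omega⟩) hB.first hd
    exact ⟨_, congrArg _ hd0⟩
  · obtain ⟨i, rfl⟩ : ∃ i, m = i + 1 := ⟨m - 1, by omega⟩
    have hk' : B.vert k = (B.dart ⟨2 * i + 1, by omega⟩).symm.fst := by
      change _ = B.vert (Fin.succ _)
      congr 1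
      ext
      simp
      omega
    by_cases hl : i + 1 = n
    · have h1 : G.deg (B.dart ⟨2 * i + 1, by omega⟩).symm.fst = 1 := by
        rw [← hk', ← hB.last]
        congr 2
        ext
        simp
        omega
      rw [eq_of_deg_one h1 (hd.trans hk')]
      exact ⟨_, SimpleGraph.Dart.edge_symm _⟩
    · have hi : 2 * i + 2 < 2 * n := by omega
      rcases eq_or_eq_of_deg_two (d := B.dart ⟨2 * i + 2, hi⟩)
        (d' := (B.dart ⟨2 * i + 1, by omega⟩).symm) (hB.deg_dart hi) rfl (B.dart_ne_symm _ _)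
        (hd.trans hk') with h1 | h1
      · exact ⟨_, congrArg _ h1⟩
      · rw [h1]
        exact ⟨_, SimpleGraph.Dart.edge_symm _⟩

end EvenDegrees

end BoundaryPath
end PlaneGraph

/-! ### Invariant sets of vertices and faces -/

namespace PlaneGraph

variable {V : Type*} {G : PlaneGraph V}

namespace BoundaryPath

variable {n : ℕ} {B : G.BoundaryPath n}

/-- There are signs, constant on the classes of bounded faces joined by dual walks through bounded
faces, that tell on which side of the path the bounded faces next to it lie. -/
theorem exists_sign [Finite V] (B : G.BoundaryPath n) : ∃ ε : G.Face → ℚ,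
    (∀ f g, BoundedAdj f g → ε f = ε g) ∧
    (∀ k, G.leftFace (B.dart k) ≠ G.outerFace → ε (G.leftFace (B.dart k)) = 1) ∧
    (∀ k, G.leftFace (B.dart k) = G.outerFace → G.leftFace (B.dart k).symm ≠ G.outerFace →
      ε (G.leftFace (B.dart k).symm) = -1) := by
  classical
  let P : G.Face → Prop := fun f => ∃ k, G.leftFace (B.dart k) ≠ G.outerFace ∧
    Relation.ReflTransGen BoundedAdj (G.leftFace (B.dart k)) f
  have hP : ∀ f g, BoundedAdj f g → P f → P g := fun f g hfg ⟨k, h1, h2⟩ => ⟨k, h1, h2.tail hfg⟩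
  refine ⟨fun f => if P f then 1 else -1, fun f g hfg => ?_, fun k hk => ?_, fun k hk hk' => ?_⟩
  · have hgf : BoundedAdj g f := by
      obtain ⟨h1, h2, d, h3, h4⟩ := hfg
      exact ⟨h2, h1, d.symm, h4, by simpa using h3⟩
    simp only [show P f ↔ P g from ⟨hP f g hfg, hP g f hgf⟩]
  · exact if_pos ⟨k, hk, Relation.ReflTransGen.refl⟩
  · refine if_neg ?_
    rintro ⟨j, hj, hr⟩
    exact B.not_reflTransGen_boundedAdj
      ((B.leftFace_dart_eq_outer_or j).resolve_left hj) hj hk hk' hr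

/-- Let `K` and `L` be sets of vertices and of bounded faces such that no edge off the path both
joins `K` to its complement and separates `L` from its complement. If, for each edge `v₂ᵢ v₂ᵢ₊₁`,
the face next to it is in `L` exactly when `v₂ᵢ₊₁` is in `K`, then no odd vertex of the path is in
`K`, and no face next to the path is in `L`. Indeed, the boundary of `L`, with the signs that make
it run along the path in one direction, is a circulation, so its total flow into `K` vanishes. For
each `v₂ᵢ` next to a face in `L`, it enters `K` at `v₂ᵢ₊₁`, so it has to leave `K` at `v₂ᵢ₋₁`, and
by hypothesis the face next to `v₂ᵢ₋₂` is in `L` as well; but next to `v₀` there is only the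
unbounded face. -/
theorem EvenDegrees.notMem_of_invariant [Finite V] (hB : B.EvenDegrees) {K : Set V}
    {L : Set G.Face} (hout : G.outerFace ∉ L)
    (hE : ∀ d : G.graph.Dart, (∀ k, d.edge ≠ (B.dart k).edge) →
      (d.fst ∈ K ↔ d.snd ∈ K) ∨ (G.leftFace d ∈ L ↔ G.leftFace d.symm ∈ L))
    (hlink : ∀ k : Fin (2 * n), Even (k : ℕ) → (B.innerFace k ∈ L ↔ B.vert k.succ ∈ K))
    (k : Fin (2 * n)) (hk : Odd (k : ℕ)) : B.vert k.castSucc ∉ K ∧ B.innerFace k ∉ L := by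
  classical
  have := Fintype.ofFinite G.graph.Dart
  obtain ⟨ε, hε, hε1, hε2⟩ := B.exists_sign
  -- membership in `K`, with each even vertex `v₂ᵢ` put on the side of `v₂ᵢ₊₁`
  let P : V → Prop := fun v =>
    if ∃ k : Fin (2 * n), Even (k : ℕ) ∧ v = B.vert k.castSucc then
      ∃ k : Fin (2 * n), Even (k : ℕ) ∧ v = B.vert k.castSucc ∧ B.vert k.succ ∈ K
    else v ∈ K
  have hPeven : ∀ k : Fin (2 * n), Even (k : ℕ) → (P (B.vert k.castSucc) ↔ B.vert k.succ ∈ K) := by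
    intro k hk
    simp only [P]
    rw [if_pos ⟨k, hk, rfl⟩]
    constructor
    · rintro ⟨j, -, h1, h2⟩
      rwa [Fin.castSucc_injective _ (B.injective h1)]
    · exact fun h => ⟨k, hk, rfl, h⟩
  have hPodd : ∀ j : Fin (2 * n + 1), Odd (j : ℕ) → (P (B.vert j) ↔ B.vert j ∈ K) := by
    intro j hj
    simp only [P]
    rw [if_neg]
    rintro ⟨k, hk, h⟩
    have h1 := congrArg Fin.val (B.injective h)
    rw [Fin.val_castSucc] at h1
    exact Nat.not_even_iff_odd.2 hj (h1 ▸ hk)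
  have hPoff : ∀ d : G.graph.Dart, (∀ k, d.edge ≠ (B.dart k).edge) → (P d.fst ↔ d.fst ∈ K) := by
    intro d hd
    simp only [P]
    rw [if_neg]
    rintro ⟨k, hk, h⟩
    obtain ⟨j, hj⟩ := hB.exists_edge_eq d _ hk h
    exact hd j hj
  let g : V → ℚ := fun v => if P v then 1 else 0
  let s : G.Face → ℚ := fun f => if f ∈ L then ε f else 0
  -- the terms of the total flow, all of which turn out to be nonpositive
  let term : G.graph.Dart → ℚ := fun d =>
    (g d.fst - g d.snd) * (s (G.leftFace d) - s (G.leftFace d.symm))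
  have hs : ∀ k, s (G.leftFace (B.dart k)) - s (G.leftFace (B.dart k).symm) =
      if B.innerFace k ∈ L then 1 else 0 := by
    intro k
    by_cases h1 : G.leftFace (B.dart k) = G.outerFace
    · rw [innerFace, if_pos h1]
      simp only [s, h1, hout, if_false]
      split_ifs with h2
      · rw [hε2 k h1 fun h3 => hout (h3 ▸ h2)]
        ring
      · ring
    · rw [innerFace, if_neg h1]
      simp only [s, (B.leftFace_dart_eq_outer_or k).resolve_left h1, hout, if_false, hε1 k h1]
      ring
  have hoff : ∀ d : G.graph.Dart, (∀ k, d.edge ≠ (B.dart k).edge) → term d = 0 := by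
    intro d hd
    rcases hE d hd with h1 | h1
    · have h2 := hPoff d hd
      have h3 : P d.snd ↔ d.snd ∈ K := hPoff d.symm fun k => d.edge_symm ▸ hd k
      simp only [term, g, h2, h3, h1, sub_self, zero_mul]
    · have h4 : s (G.leftFace d) = s (G.leftFace d.symm) := by
        simp only [s, ← h1]
        split_ifs with h2
        · exact hε _ _ ⟨fun h3 => hout (h3 ▸ h2), fun h3 => hout (h3 ▸ h1.1 h2), d, rfl, rfl⟩
        · rfl
      simp only [term, h4, sub_self, mul_zero]
  have hon : ∀ k : Fin (2 * n), term (B.dart k) ≤ 0 ∧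
      (term (B.dart k) = 0 → Odd (k : ℕ) → B.innerFace k ∈ L → B.vert k.castSucc ∈ K) := by
    intro k
    have hterm : term (B.dart k) = (g (B.vert k.castSucc) - g (B.vert k.succ)) *
        if B.innerFace k ∈ L then 1 else 0 := by
      rw [← hs]
      rfl
    rcases Nat.even_or_odd k with hk | hk
    · have h1 : Odd (k.succ : ℕ) := by
        rw [Fin.val_succ]
        exact hk.add_one
      have : g (B.vert k.castSucc) = g (B.vert k.succ) := by
        simp only [g, hPeven k hk, hPodd _ h1]
      rw [hterm, this]
      refine ⟨by simp, fun _ h => absurd hk (Nat.not_even_iff_odd.2 h)⟩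
    · by_cases h1 : B.innerFace k ∈ L
      · obtain ⟨i, hi⟩ := hk
        have hk2 := k.2
        have h2 : 2 * i + 2 < 2 * n := by
          by_contra h2
          have h3 : k = ⟨2 * n - 1, by omega⟩ := by
            ext
            simp
            omega
          rw [h3, hB.innerFace_last] at h1
          exact hout h1
        have h3 : k = ⟨2 * i + 1, by omega⟩ := Fin.ext hi
        have h4 : P (B.vert k.succ) := by
          have h5 := h1
          rw [h3, ← hB.innerFace_eq h2] at h5
          have hev : Even ((⟨2 * i + 2, h2⟩ : Fin (2 * n)) : ℕ) := ⟨i + 1, by simp; ring⟩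
          have h6 := (hPeven _ hev).2 ((hlink _ hev).1 h5)
          convert h6 using 2
          ext
          simp [hi]
        have h5 := hPodd k.castSucc ⟨i, by simpa using hi⟩
        rw [hterm, if_pos h1, mul_one]
        simp only [g, if_pos h4, h5]
        split_ifs with h6
        · exact ⟨by simp, fun _ _ _ => h6⟩
        · refine ⟨by simp, fun h => by norm_num at h⟩
      · exact ⟨by simp [hterm, h1], fun _ _ h => absurd h h1⟩
  have hsymm : ∀ d, term d.symm = term d := by
    intro d
    simp only [term, SimpleGraph.Dart.symm_symm]
    change (g d.snd - g d.fst) * _ = _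
    ring
  have hnonpos : ∀ d, term d ≤ 0 := by
    intro d
    by_cases h : ∀ k, d.edge ≠ (B.dart k).edge
    · exact (hoff d h).le
    · push Not at h
      obtain ⟨k, hk⟩ := h
      rcases (SimpleGraph.dart_edge_eq_iff _ _).1 hk with rfl | rfl
      · exact (hon k).1
      · exact (hsymm _).le.trans (hon k).1
  have hzero : ∀ d, term d = 0 := fun d =>
    (Finset.sum_eq_zero_iff_of_nonpos fun d _ => hnonpos d).1
      (sum_sub_mul_leftFace_sub (G := G) g s) d (Finset.mem_univ d)
  have hback : ∀ k : Fin (2 * n), Odd (k : ℕ) → B.innerFace k ∈ L → B.vert k.castSucc ∈ K :=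
    fun k => (hon k).2 (hzero _)
  have hn := hB.pos
  have heven : ∀ i : ℕ, ∀ h : 2 * i < 2 * n, B.innerFace ⟨2 * i, h⟩ ∉ L := by
    intro i
    induction i with
    | zero =>
      intro h
      rw [show (⟨2 * 0, h⟩ : Fin (2 * n)) = ⟨0, by omega⟩ from rfl, hB.innerFace_first]
      exact hout
    | succ i ih =>
      intro h h1
      rw [show (⟨2 * (i + 1), h⟩ : Fin (2 * n)) = ⟨2 * i + 2, h⟩ from rfl, hB.innerFace_eq] at h1
      have h2 := hback _ ⟨i, rfl⟩ h1
      exact ih (by omega) ((hlink ⟨2 * i, by omega⟩ ⟨i, by simp; ring⟩).2 h2)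
  have hodd : B.vert k.castSucc ∉ K := by
    obtain ⟨i, hi⟩ := hk
    intro h
    have hk2 := k.2
    refine heven i (by omega) ((hlink ⟨2 * i, by omega⟩ ⟨i, by simp; ring⟩).2 ?_)
    convert h using 2
    ext
    simp [hi]
  exact ⟨hodd, fun h => hodd (hback k hk h)⟩

end BoundaryPath
end PlaneGraph

/-! ### Assigning edges to the nodes of a tree -/

/-- Let `n` edges `a i`, `b i` connect `n` distinct nodes `t k` to a root. Then the edges form a
tree on these nodes, and there is exactly one bijective way to choose for each edge one of its ends
other than the root: the end farther from the root. -/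
theorem existsUnique_perm_of_connected {W : Type*} {n : ℕ} (a b t : Fin n → W) (r : W)
    (ht : Function.Injective t) (hr : ∀ k, t k ≠ r)
    (hconn : ∀ K : Set W, r ∉ K → (∀ i, a i ∈ K ↔ b i ∈ K) → ∀ k, t k ∉ K) :
    ∃! τ : Equiv.Perm (Fin n), ∀ i, t (τ i) = a i ∨ t (τ i) = b i := by
  classical
  let H : SimpleGraph W := SimpleGraph.fromRel fun x y => ∃ i, x = a i ∧ y = b i
  have hreach : ∀ k, H.Reachable (t k) r := by
    intro k
    by_contra hk
    refine hconn {w | ¬ H.Reachable w r} (fun h => h (SimpleGraph.Reachable.refl _)) (fun i => ?_)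
      k hk
    by_cases hab : a i = b i
    · rw [hab]
    · have hadj : H.Adj (a i) (b i) := (SimpleGraph.fromRel_adj _ _ _).2 ⟨hab, Or.inl ⟨i, rfl, rfl⟩⟩
      exact not_congr ⟨fun h => hadj.symm.reachable.trans h, fun h => hadj.reachable.trans h⟩
  have hpar : ∀ k, ∃ p i, H.dist p r < H.dist (t k) r ∧
      ((t k = a i ∧ p = b i) ∨ (t k = b i ∧ p = a i)) := by
    intro k
    obtain ⟨w, hw⟩ := (hreach k).exists_walk_length_eq_dist
    cases w with
    | nil => exact absurd rfl (hr _)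
    | @cons _ p _ hadj q =>
      rw [SimpleGraph.Walk.length_cons] at hw
      have h1 := SimpleGraph.dist_le q
      obtain ⟨-, ⟨i, h2, h3⟩ | ⟨i, h2, h3⟩⟩ := (SimpleGraph.fromRel_adj _ _ _).1 hadj
      · exact ⟨p, i, by omega, Or.inl ⟨h2, h3⟩⟩
      · exact ⟨p, i, by omega, Or.inr ⟨h3, h2⟩⟩
  choose p e hp he using hpar
  have hinj : Function.Injective e := by
    intro k k' h
    by_contra hne
    have hkk : t k ≠ t k' := fun h => hne (ht h)
    have h1 := he k
    have h2 := he k'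
    rw [← h] at h2
    have h3 := hp k
    have h4 := hp k'
    have h5 : t k = p k' ∧ t k' = p k := by
      rcases h1 with ⟨h1, h1'⟩ | ⟨h1, h1'⟩ <;> rcases h2 with ⟨h2, h2'⟩ | ⟨h2, h2'⟩
      · exact absurd (h1.trans h2.symm) hkk
      · exact ⟨h1.trans h2'.symm, h2.trans h1'.symm⟩
      · exact ⟨h1.trans h2'.symm, h2.trans h1'.symm⟩
      · exact absurd (h1.trans h2.symm) hkk
    rw [h5.1] at h3
    rw [h5.2] at h4
    omega
  let σ : Equiv.Perm (Fin n) := Equiv.ofBijective e (Finite.injective_iff_bijective.1 hinj)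
  have hσ : ∀ k, σ k = e k := fun _ => rfl
  refine ⟨σ.symm, fun i => ?_, fun τ hτ => ?_⟩
  · have h1 := he (σ.symm i)
    rw [← hσ, Equiv.apply_symm_apply] at h1
    exact h1.imp And.left And.left
  · have key : ∀ m k, H.dist (t k) r = m → τ (e k) = k := by
      intro m
      induction m using Nat.strong_induction_on with
      | _ m ih =>
        intro k hk
        by_contra hne
        have h1 : t (τ (e k)) = p k := by
          have hne' : t (τ (e k)) ≠ t k := fun h => hne (ht h)
          rcases hτ (e k) with h1 | h1 <;> rcases he k with ⟨h2, h3⟩ | ⟨h2, h3⟩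
          · exact absurd (h1.trans h2.symm) hne'
          · exact h1.trans h3.symm
          · exact h1.trans h3.symm
          · exact absurd (h1.trans h2.symm) hne'
        have h2 := hp k
        rw [← h1] at h2
        have h3 := ih _ (hk ▸ h2) _ rfl
        exact hne (hinj (τ.injective h3))
    ext i
    obtain ⟨k, rfl⟩ := σ.surjective i
    rw [Equiv.symm_apply_apply, hσ, key _ k rfl]

/-! ### Perfect matchings as sets of edges -/

/-- `E` is the edge set of a perfect matching of the graph obtained from `H` by deleting `S`. -/
structure IsPerfectMatchingOff {W : Type*} (H : SimpleGraph W) (S : Set W) (E : Set (Sym2 W)) :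
    Prop where
  adj {x y} : s(x, y) ∈ E → H.Adj x y
  notMem {x y} : s(x, y) ∈ E → x ∉ S
  exists_mem {x} : x ∉ S → ∃ y, s(x, y) ∈ E
  unique {x y z} : s(x, y) ∈ E → s(x, z) ∈ E → y = z

theorem IsPerfectMatchingOff.unique' {W : Type*} {H : SimpleGraph W} {S : Set W} {E : Set (Sym2 W)}
    (hE : IsPerfectMatchingOff H S E) {x y z : W} (h1 : s(y, x) ∈ E) (h2 : s(z, x) ∈ E) : y = z :=
  hE.unique (Sym2.eq_swap ▸ h1) (Sym2.eq_swap ▸ h2)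

theorem IsPerfectMatchingOff.notMem' {W : Type*} {H : SimpleGraph W} {S : Set W} {E : Set (Sym2 W)}
    (hE : IsPerfectMatchingOff H S E) {x y : W} (h1 : s(y, x) ∈ E) : x ∉ S :=
  hE.notMem (Sym2.eq_swap ▸ h1)

namespace PlaneGraph

variable {V : Type*} {G : PlaneGraph V}

theorem mk_mem_matchingEdges {S : Set G.HVertex} {H : SimpleGraph S} (μ : PerfectMatchings H)
    (x y : G.HVertex) : s(x, y) ∈ matchingEdges μ ↔ ∃ hx hy, μ.1.Adj ⟨x, hx⟩ ⟨y, hy⟩ := by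
  constructor
  · rintro ⟨e, he, hxy⟩
    induction e with
    | _ a b =>
      rw [SimpleGraph.Subgraph.mem_edgeSet] at he
      rw [Sym2.map_mk, Sym2.eq_iff] at hxy
      rcases hxy with ⟨rfl, rfl⟩ | ⟨rfl, rfl⟩
      · exact ⟨a.2, b.2, he⟩
      · exact ⟨b.2, a.2, he.symm⟩
  · rintro ⟨hx, hy, h⟩
    exact ⟨s(⟨x, hx⟩, ⟨y, hy⟩), h, rfl⟩

theorem matchingEdges_injective {S : Set G.HVertex} {H : SimpleGraph S} :
    Function.Injective (matchingEdges : PerfectMatchings H → _) := by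
  intro μ ν h
  apply Subtype.ext
  have hadj : ∀ x y : S, μ.1.Adj x y ↔ ν.1.Adj x y := by
    intro x y
    have h1 := mk_mem_matchingEdges μ x y
    rw [h, mk_mem_matchingEdges ν x y] at h1
    exact ⟨fun h2 => (h1.2 ⟨x.2, y.2, h2⟩).2.2, fun h2 => (h1.1 ⟨x.2, y.2, h2⟩).2.2⟩
  apply SimpleGraph.Subgraph.ext
  · rw [μ.2.2.verts_eq_univ, ν.2.2.verts_eq_univ]
  · funext x y
    exact propext (hadj x y)

theorem isPerfectMatchingOff_matchingEdges {H : SimpleGraph G.HVertex} {S : Set G.HVertex}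
    (μ : PerfectMatchings (H.induce Sᶜ)) : IsPerfectMatchingOff H S (matchingEdges μ) where
  adj h := by
    obtain ⟨hx, hy, h⟩ := (mk_mem_matchingEdges μ _ _).1 h
    exact h.adj_sub
  notMem h := ((mk_mem_matchingEdges μ _ _).1 h).1
  exists_mem {x} hx := by
    obtain ⟨y, hy, -⟩ := μ.2.1 (μ.2.2 ⟨x, hx⟩)
    exact ⟨y, (mk_mem_matchingEdges μ _ _).2 ⟨hx, y.2, hy⟩⟩
  unique {x y z} h1 h2 := by
    obtain ⟨hx, hy, h1⟩ := (mk_mem_matchingEdges μ _ _).1 h1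
    obtain ⟨_, hz, h3⟩ := (mk_mem_matchingEdges μ _ _).1 h2
    exact congrArg Subtype.val ((μ.2.1 (μ.2.2 ⟨x, hx⟩)).unique h1 h3)

theorem exists_matchingEdges_eq {H : SimpleGraph G.HVertex}
    {S : Set G.HVertex} {E : Set (Sym2 G.HVertex)} (hE : IsPerfectMatchingOff H S E) :
    ∃ μ : PerfectMatchings (H.induce Sᶜ), matchingEdges μ = E := by
  let M : (H.induce Sᶜ).Subgraph :=
    { verts := Set.univ
      Adj := fun x y => s(x.1, y.1) ∈ E
      adj_sub := fun h => hE.adj h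
      edge_vert := fun _ => trivial
      symm := ⟨fun _ _ h => Sym2.eq_swap ▸ h⟩ }
  have hM : M.IsPerfectMatching := by
    refine ⟨?_, fun _ => trivial⟩
    rintro ⟨x, hx⟩ -
    obtain ⟨y, hy⟩ := hE.exists_mem hx
    exact ⟨⟨y, hE.notMem' hy⟩, hy, fun z hz => Subtype.ext (hE.unique hz hy)⟩
  refine ⟨⟨M, hM⟩, ?_⟩
  ext e
  induction e with
  | _ x y =>
    exact (mk_mem_matchingEdges _ _ _).trans ⟨fun ⟨_, _, h⟩ => h, fun h =>
      ⟨hE.notMem h, hE.notMem' h, h⟩⟩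

/-! ### Incidences in the dual refinement -/

theorem adj_edge_orig {e : G.graph.edgeSet} {v : V} :
    G.dualRefinement.Adj (.edge e) (.orig v) ↔ v ∈ (e : Sym2 V) := by
  simp [dualRefinement, SimpleGraph.fromRel_adj, Incident]

theorem adj_edge_face {e : G.graph.edgeSet} {f : {f : G.Face // f ≠ G.outerFace}} :
    G.dualRefinement.Adj (.edge e) (.face f) ↔ G.EdgeOnFace e f := by
  simp [dualRefinement, SimpleGraph.fromRel_adj, Incident]

/-- Both vertices are original vertices, or both are face-vertices. -/
def SameKind : G.HVertex → G.HVertex → Prop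
  | .orig _, .orig _ => True
  | .face _, .face _ => True
  | _, _ => False

theorem SameKind.trans {x y z : G.HVertex} (h1 : SameKind x y) (h2 : SameKind y z) :
    SameKind x z := by
  cases x <;> cases y <;> cases z <;> simp_all [SameKind]

theorem SameKind.symm {x y : G.HVertex} (h1 : SameKind x y) : SameKind y x := by
  cases x <;> cases y <;> simp_all [SameKind]

theorem not_sameKind_edge {x : G.HVertex} {e : G.graph.edgeSet} : ¬ SameKind x (.edge e) := by
  cases x <;> simp [SameKind]

theorem exists_edge_of_adj {x y : G.HVertex} (hx : SameKind x x) (h : G.dualRefinement.Adj x y) :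
    ∃ e, y = .edge e := by
  cases x <;> cases y <;> simp_all [SameKind, dualRefinement, SimpleGraph.fromRel_adj, Incident]

theorem sameKind_of_adj {e : G.graph.edgeSet} {y : G.HVertex}
    (h : G.dualRefinement.Adj (.edge e) y) : SameKind y y := by
  cases y <;> simp_all [SameKind, dualRefinement, SimpleGraph.fromRel_adj, Incident]

theorem sameKind_self_or (x : G.HVertex) : SameKind x x ∨ ∃ e, x = .edge e := by
  cases x <;> simp [SameKind]

/-- An edge-vertex has at most two neighbors of each kind. -/
theorem eq_of_adj_of_adj {e : G.graph.edgeSet} {x y z : G.HVertex}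
    (hx : G.dualRefinement.Adj (.edge e) x) (hy : G.dualRefinement.Adj (.edge e) y)
    (hz : G.dualRefinement.Adj (.edge e) z) (hxy : SameKind x y) (hxz : SameKind x z)
    (hyx : y ≠ x) (hzx : z ≠ x) : y = z := by
  obtain ⟨d, rfl⟩ := exists_dart_edge e
  cases x <;> cases y <;> cases z <;>
    first | exact False.elim hxy | exact False.elim hxz | skip
  · rename_i u v w
    rw [adj_edge_orig] at hx hy hz
    congr 1
    change u ∈ s(d.fst, d.snd) at hx
    change v ∈ s(d.fst, d.snd) at hy
    change w ∈ s(d.fst, d.snd) at hz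
    rw [Sym2.mem_iff] at hx hy hz
    rcases hx with rfl | rfl <;> rcases hy with rfl | rfl <;> rcases hz with rfl | rfl <;> simp_all
  · rename_i f g h
    rw [adj_edge_face, edgeOnFace_iff] at hx hy hz
    congr 1
    apply Subtype.ext
    have h1 : g.1 ≠ f.1 := fun h => hyx (congrArg _ (Subtype.ext h))
    have h2 : h.1 ≠ f.1 := fun h => hzx (congrArg _ (Subtype.ext h))
    rcases hx with hx | hx <;> rcases hy with hy | hy <;> rcases hz with hz | hz <;> simp_all

namespace BoundaryPath

variable {n : ℕ} (B : G.BoundaryPath n)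

theorem mid_eq (k : Fin (2 * n)) : B.mid k = .edge ⟨(B.dart k).edge, (B.dart k).edge_mem⟩ := rfl

theorem mid_injective : Function.Injective B.mid := by
  intro i k h
  rw [mid_eq, mid_eq, HVertex.edge.injEq, Subtype.mk.injEq] at h
  exact B.dart_edge_injective h

theorem edge_notMem_evenVertices (e : G.graph.edgeSet) : HVertex.edge e ∉ B.evenVertices := by
  rintro ⟨k, -, h⟩
  cases h

theorem mid_notMem_evenVertices (k : Fin (2 * n)) : B.mid k ∉ B.evenVertices :=
  B.edge_notMem_evenVertices _

theorem face_notMem_evenVertices (f : {f : G.Face // f ≠ G.outerFace}) :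
    HVertex.face f ∉ B.evenVertices := by
  rintro ⟨k, -, h⟩
  cases h

theorem orig_mem_evenVertices (j : Fin (2 * n + 1)) :
    HVertex.orig (B.vert j) ∈ B.evenVertices ↔ Even (j : ℕ) := by
  constructor
  · rintro ⟨k, hk, h⟩
    rw [HVertex.orig.injEq] at h
    rwa [B.injective h]
  · exact fun h => ⟨j, h, rfl⟩

theorem mid_adj_orig (k : Fin (2 * n)) (v : V) : G.dualRefinement.Adj (B.mid k) (.orig v) ↔
    v = B.vert k.castSucc ∨ v = B.vert k.succ := by
  rw [mid, adj_edge_orig, Sym2.mem_iff]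

theorem mid_adj_face (k : Fin (2 * n)) (f : {f : G.Face // f ≠ G.outerFace}) :
    G.dualRefinement.Adj (B.mid k) (.face f) ↔ f.1 = B.innerFace k := by
  rw [mid_eq, adj_edge_face, edgeOnFace_dart_iff]
  simp [f.2]

/-- The vertices deleted in `G⁺`. -/
def plusDeleted : Set G.HVertex :=
  B.evenVertices ∪ {x | ∃ k : Fin (2 * n), Even (k : ℕ) ∧ x = B.mid k}

/-- The vertices deleted in `G⁻`. -/
def minusDeleted : Set G.HVertex :=
  B.evenVertices ∪ {x | ∃ k : Fin (2 * n), Odd (k : ℕ) ∧ x = B.mid k}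

/-- `BoundaryPath.IsShift` for the edge sets of two matchings. -/
def IsEdgeShift (E E' : Set (Sym2 G.HVertex)) : Prop :=
  ∃ (τ : Equiv.Perm (Fin n))
    (P : ∀ i : Fin n, G.dualRefinement.Walk
      (B.mid ⟨2 * i, by omega⟩) (B.mid ⟨2 * τ i + 1, by omega⟩)),
    (∀ i, (P i).IsPath) ∧
    (∀ i, ∀ x ∈ (P i).support, x ∉ B.evenVertices) ∧
    (∀ i, OnFrame (P i) ∨ OnDualFrame (P i)) ∧
    (∀ i j, i ≠ j → ∀ x ∈ (P i).support, x ∉ (P j).support) ∧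
    E' = E ∆ {e | ∃ i, e ∈ (P i).edges}

/-- From a vertex of `H_G` other than an edge-vertex, go to the edge-vertex matched to it and on to
the next vertex of the same kind, provided that this one is not deleted. -/
def Step (E : Set (Sym2 G.HVertex)) (x y : G.HVertex) : Prop :=
  ∃ e, s(x, HVertex.edge e) ∈ E ∧ G.dualRefinement.Adj (.edge e) y ∧ SameKind x y ∧ y ≠ x ∧
    y ∉ B.evenVertices

/-- The steps of `Step`, with an additional vertex `none` for the unbounded face. Steps to it across
the edges of the path are left out: these are the ends of the paths along which to shift. -/
inductive StepOut (E : Set (Sym2 G.HVertex)) : Option G.HVertex → Option G.HVertex → Prop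
  | step {x y} : B.Step E x y → StepOut E (some x) (some y)
  | out {f} {e : G.graph.edgeSet} : s(.face f, .edge e) ∈ E →
      (∀ k, (e : Sym2 V) ≠ (B.dart k).edge) →
      G.EdgeOnFace e G.outerFace → StepOut E (some (.face f)) none

end BoundaryPath
end PlaneGraph

/-! ### The paths to the ends -/

/-- In the graph of a partial function, a point from which an end is reached lies on no cycle. -/
theorem not_transGen_self {α : Type*} {r : α → α → Prop} (hr : Relator.RightUnique r) {x y : α}
    (hy : ∀ z, ¬ r y z) (h : Relation.ReflTransGen r x y) : ¬ Relation.TransGen r x x := by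
  induction h using Relation.ReflTransGen.head_induction_on with
  | refl =>
    intro h
    obtain ⟨z, hz, -⟩ := Relation.TransGen.head'_iff.1 h
    exact hy z hz
  | head hxz _ ih =>
    intro h
    obtain ⟨z', hz', h⟩ := Relation.TransGen.head'_iff.1 h
    obtain rfl := hr hxz hz'
    exact ih (Relation.TransGen.tail' h hxz)

/-- In the graph of a partial function, a class of the generated equivalence relation that contains
an end consists of the points from which this end is reached. -/
theorem reflTransGen_of_quot_eq {α : Type*} {r : α → α → Prop} (hr : Relator.RightUnique r)
    {x y : α} (hy : ∀ z, ¬ r y z) (h : Quot.mk r x = Quot.mk r y) :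
    Relation.ReflTransGen r x y := by
  have hjoin := Relation.equivalence_join_reflTransGen (r := r) fun a b c hab hac =>
    ⟨c, by rw [hr hab hac]; exact ⟨Relation.ReflGen.refl, Relation.ReflTransGen.refl⟩⟩
  have h1 : ∀ a b, Relation.EqvGen r a b → Relation.Join (Relation.ReflTransGen r) a b := by
    intro a b hab
    induction hab with
    | rel a b h => exact ⟨b, Relation.ReflTransGen.single h, Relation.ReflTransGen.refl⟩
    | refl a => exact hjoin.refl a
    | symm a b _ ih => exact hjoin.symm ih
    | trans a b c _ _ ih1 ih2 => exact hjoin.trans ih1 ih2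
  obtain ⟨z, h2, h3⟩ := h1 _ _ (Quot.eqvGen_exact h)
  rcases Relation.ReflTransGen.cases_head h3 with rfl | ⟨w, hw, -⟩
  · exact h2
  · exact absurd hw (hy w)

namespace PlaneGraph

variable {V : Type*} {G : PlaneGraph V}

namespace BoundaryPath

variable {n : ℕ} {B : G.BoundaryPath n} {S : Set G.HVertex} {E : Set (Sym2 G.HVertex)}

theorem step_rightUnique (hE : IsPerfectMatchingOff G.dualRefinement S E) :
    Relator.RightUnique (B.Step E) := by
  rintro x y z ⟨e, he, h1, h2, h3, -⟩ ⟨e', he', h1', h2', h3', -⟩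
  rw [hE.unique he' he] at h1'
  exact eq_of_adj_of_adj (hE.adj he).symm h1 h1' h2 h2' h3 h3'

theorem stepOut_rightUnique (hE : IsPerfectMatchingOff G.dualRefinement S E) :
    Relator.RightUnique (B.StepOut E) := by
  have key : ∀ {f} {e : G.graph.edgeSet} {y}, s(HVertex.face f, .edge e) ∈ E →
      G.EdgeOnFace e G.outerFace → ¬ B.Step E (.face f) y := by
    rintro f e y he ho ⟨e', he', h1, h2, h3, -⟩
    rw [hE.unique he' he] at h1
    have h4 := (hE.adj he).symm
    cases y with
    | face g =>
      obtain ⟨d, rfl⟩ := exists_dart_edge e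
      rw [adj_edge_face, edgeOnFace_iff] at h1 h4
      rw [edgeOnFace_iff] at ho
      have h5 : g.1 ≠ f.1 := fun h => h3 (congrArg _ (Subtype.ext h))
      have hf := f.2
      have hg := g.2
      rcases h1 with h1 | h1 <;> rcases h4 with h4 | h4 <;> rcases ho with ho | ho <;> simp_all
    | orig v => exact h2
    | edge e => exact h2
  rintro _ _ _ (h1 | ⟨h1, h2, h3⟩) (h4 | ⟨h4, h5, h6⟩)
  · exact congrArg _ (step_rightUnique hE h1 h4)
  · exact absurd h1 (key h4 h6)
  · exact absurd h4 (key h1 h3)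
  · rfl

theorem reflTransGen_step_of_stepOut {x y : G.HVertex}
    (h : Relation.ReflTransGen (B.StepOut E) (some x) (some y)) :
    Relation.ReflTransGen (B.Step E) x y := by
  generalize hx : some x = a at h
  induction h using Relation.ReflTransGen.head_induction_on generalizing x with
  | refl =>
    cases hx
    exact Relation.ReflTransGen.refl
  | @head a b hab hb ih =>
    cases hab with
    | step h =>
      cases hx
      exact Relation.ReflTransGen.head h (ih rfl)
    | out h1 h2 h3 =>
      rcases Relation.ReflTransGen.cases_head hb with h | ⟨c, hc, -⟩
      · cases h
      · cases hc

theorem Step.sameKind {x y : G.HVertex} (h : B.Step E x y) : SameKind x y := by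
  obtain ⟨e, -, -, h, -⟩ := h
  exact h

theorem Step.notMem {x y : G.HVertex} (h : B.Step E x y) : y ∉ B.evenVertices := by
  obtain ⟨e, -, -, -, -, h⟩ := h
  exact h

theorem Step.ne {x y : G.HVertex} (h : B.Step E x y) : y ≠ x := by
  obtain ⟨e, -, -, -, h, -⟩ := h
  exact h

theorem sameKind_of_reflTransGen {x y : G.HVertex} (hx : SameKind x x)
    (h : Relation.ReflTransGen (B.Step E) x y) : SameKind x y := by
  induction h with
  | refl => exact hx
  | tail _ h ih => exact ih.trans h.sameKind

/-- The vertices `v₂ₖ₊₁` and the bounded faces matched to edges `v₂ₖ₊₁ v₂ₖ₊₂` are the ends of the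
steps. -/
theorem not_stepOut (hE : IsPerfectMatchingOff G.dualRefinement B.plusDeleted E) {k : Fin (2 * n)}
    (hk : Odd (k : ℕ)) {y : G.HVertex} (hy : s(y, B.mid k) ∈ E) (z : Option G.HVertex) :
    ¬ B.StepOut E (some y) z := by
  have hadj := (hE.adj hy).symm
  rintro (⟨e, he, h1, h2, h3, h4⟩ | ⟨h1, h2, -⟩)
  · rename_i z
    rw [hE.unique he hy] at h1
    cases y with
    | orig v =>
      cases z with
      | orig w =>
        rw [mid_adj_orig] at h1 hadj
        have hev : Even (k.succ : ℕ) := by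
          rw [Fin.val_succ]
          exact hk.add_one
        have hv : HVertex.orig v ∉ B.evenVertices := fun h => hE.notMem hy (Or.inl h)
        have hw : w = B.vert k.castSucc := h1.resolve_right fun h =>
          h4 (h ▸ (B.orig_mem_evenVertices _).2 hev)
        have hv : v = B.vert k.castSucc := hadj.resolve_right fun h =>
          hv (h ▸ (B.orig_mem_evenVertices _).2 hev)
        exact h3 (by rw [hv, hw])
      | face g => exact h2
      | edge e => exact h2
    | face f =>
      cases z with
      | face g =>
        rw [mid_adj_face] at h1 hadj
        exact h3 (congrArg _ (Subtype.ext (h1.trans hadj.symm)))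
      | orig w => exact h2
      | edge e => exact h2
    | edge e => exact not_sameKind_edge h2.symm
  · have h3 := hE.unique h1 hy
    rw [mid_eq, HVertex.edge.injEq] at h3
    exact h2 k (congrArg _ h3)

theorem not_step (hE : IsPerfectMatchingOff G.dualRefinement B.plusDeleted E) {k : Fin (2 * n)}
    (hk : Odd (k : ℕ)) {y : G.HVertex} (hy : s(y, B.mid k) ∈ E) (z : G.HVertex) :
    ¬ B.Step E y z := fun h => not_stepOut hE hk hy _ (StepOut.step h)

/-- The edges of the path in `H_G` that runs along the steps from `x`. -/
def pathEdges (B : G.BoundaryPath n) (E : Set (Sym2 G.HVertex)) (x : G.HVertex) :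
    Set (Sym2 G.HVertex) :=
  {a | ∃ z c, Relation.ReflTransGen (B.Step E) x z ∧ s(z, c) ∈ E ∧
    (a = s(z, c) ∨ ∃ z', B.Step E z z' ∧ a = s(z', c))}

theorem pathEdges_of_not_step (hE : IsPerfectMatchingOff G.dualRefinement S E) {x c : G.HVertex}
    (hx : ∀ z, ¬ B.Step E x z) (hc : s(x, c) ∈ E) : B.pathEdges E x = {s(x, c)} := by
  ext a
  constructor
  · rintro ⟨z, c', h1, h2, h3⟩
    rcases Relation.ReflTransGen.cases_head h1 with rfl | ⟨w, hw, -⟩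
    · rcases h3 with rfl | ⟨z', h3, -⟩
      · rw [hE.unique h2 hc]
        rfl
      · exact absurd h3 (hx _)
    · exact absurd hw (hx _)
  · rintro rfl
    exact ⟨x, c, Relation.ReflTransGen.refl, hc, Or.inl rfl⟩

theorem pathEdges_of_step (hE : IsPerfectMatchingOff G.dualRefinement S E) {x y c : G.HVertex}
    (hxy : B.Step E x y) (hc : s(x, c) ∈ E) :
    B.pathEdges E x = {s(x, c), s(y, c)} ∪ B.pathEdges E y := by
  ext a
  constructor
  · rintro ⟨z, c', h1, h2, h3⟩
    rcases Relation.ReflTransGen.cases_head h1 with rfl | ⟨w, hw, h4⟩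
    · left
      rw [hE.unique h2 hc] at h3
      rcases h3 with rfl | ⟨z', h3, rfl⟩
      · exact Or.inl rfl
      · rw [step_rightUnique hE h3 hxy]
        exact Or.inr rfl
    · rw [step_rightUnique hE hw hxy] at h4
      exact Or.inr ⟨z, c', h4, h2, h3⟩
  · rintro ((rfl | rfl) | ⟨z, c', h1, h2, h3⟩)
    · exact ⟨x, c, Relation.ReflTransGen.refl, hc, Or.inl rfl⟩
    · exact ⟨x, c, Relation.ReflTransGen.refl, hc, Or.inr ⟨y, hxy, rfl⟩⟩
    · exact ⟨z, c', Relation.ReflTransGen.head hxy h1, h2, h3⟩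

theorem mem_pathEdges_iff (hE : IsPerfectMatchingOff G.dualRefinement S E) {x z c : G.HVertex}
    (hx : SameKind x x) (hz : SameKind z z) : s(z, c) ∈ B.pathEdges E x ↔
      (Relation.ReflTransGen (B.Step E) x z ∧ s(z, c) ∈ E) ∨
        ∃ z', Relation.ReflTransGen (B.Step E) x z' ∧ B.Step E z' z ∧ s(z', c) ∈ E := by
  constructor
  · rintro ⟨z', c', h1, h2, h3⟩
    have hz' := sameKind_of_reflTransGen hx h1
    obtain ⟨e, rfl⟩ := exists_edge_of_adj (hz'.symm.trans hz') (hE.adj h2)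
    have hze : z ≠ .edge e := by
      rintro rfl
      exact not_sameKind_edge hz
    rcases h3 with h3 | ⟨w, h4, h3⟩
    · rcases Sym2.eq_iff.1 h3 with ⟨rfl, rfl⟩ | ⟨h, -⟩
      · exact Or.inl ⟨h1, h2⟩
      · exact absurd h hze
    · rcases Sym2.eq_iff.1 h3 with ⟨rfl, rfl⟩ | ⟨h, -⟩
      · exact Or.inr ⟨z', h1, h4, h2⟩
      · exact absurd h hze
  · rintro (⟨h1, h2⟩ | ⟨z', h1, h2, h3⟩)
    · exact ⟨z, c, h1, h2, Or.inl rfl⟩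
    · exact ⟨z', c, h1, h3, Or.inr ⟨z, h2, rfl⟩⟩

/-- The steps from `x` to an end `y` trace a path in `H_G`. -/
theorem exists_path (hE : IsPerfectMatchingOff G.dualRefinement S E) {x y c : G.HVertex}
    (hx : SameKind x x) (h : Relation.ReflTransGen (B.Step E) x y) (hy : ∀ z, ¬ B.Step E y z)
    (hc : s(y, c) ∈ E) : ∃ P : G.dualRefinement.Walk x c, P.IsPath ∧
      (∀ z ∈ P.support, Relation.ReflTransGen (B.Step E) x z ∨
        ∃ z', Relation.ReflTransGen (B.Step E) x z' ∧ s(z', z) ∈ E) ∧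
      ∀ a, a ∈ P.edges ↔ a ∈ B.pathEdges E x := by
  induction h using Relation.ReflTransGen.head_induction_on with
  | refl =>
    refine ⟨(hE.adj hc).toWalk, ?_, ?_, ?_⟩
    · rw [SimpleGraph.Walk.cons_isPath_iff]
      exact ⟨SimpleGraph.Walk.IsPath.nil, by simpa using (hE.adj hc).ne⟩
    · intro z hz
      simp at hz
      rcases hz with rfl | rfl
      · exact Or.inl Relation.ReflTransGen.refl
      · exact Or.inr ⟨y, Relation.ReflTransGen.refl, hc⟩
    · intro a
      rw [pathEdges_of_not_step hE hy hc]
      simp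
  | @head x x' hxx' hx'y ih =>
    have hcyc := not_transGen_self (step_rightUnique hE) hy
      (Relation.ReflTransGen.head hxx' hx'y)
    have hx' : SameKind x' x' := hxx'.sameKind.symm.trans hxx'.sameKind
    obtain ⟨P, h1, h2, h3⟩ := ih hx'
    have hstep := hxx'
    obtain ⟨e, he, h4, -⟩ := hxx'
    have h5 : HVertex.edge e ∉ P.support := by
      intro h
      rcases h2 _ h with h | ⟨z', h6, h7⟩
      · exact not_sameKind_edge (sameKind_of_reflTransGen hx' h)
      · rw [hE.unique' h7 he] at h6
        exact hcyc (Relation.TransGen.head' hstep h6)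
    have h6 : x ∉ P.support := by
      intro h
      rcases h2 _ h with h | ⟨z', h6, h7⟩
      · exact hcyc (Relation.TransGen.head' hstep h)
      · rw [Sym2.eq_swap] at h7
        rw [hE.unique h7 he] at h6
        exact not_sameKind_edge (sameKind_of_reflTransGen hx' h6)
    refine ⟨.cons (hE.adj he) (.cons h4 P), ?_, ?_, ?_⟩
    · rw [SimpleGraph.Walk.cons_isPath_iff, SimpleGraph.Walk.cons_isPath_iff]
      refine ⟨⟨h1, h5⟩, ?_⟩
      rw [SimpleGraph.Walk.support_cons, List.mem_cons, not_or]
      exact ⟨(hE.adj he).ne, h6⟩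
    · intro z hz
      rw [SimpleGraph.Walk.support_cons, SimpleGraph.Walk.support_cons, List.mem_cons,
        List.mem_cons] at hz
      rcases hz with rfl | rfl | hz
      · exact Or.inl Relation.ReflTransGen.refl
      · exact Or.inr ⟨x, Relation.ReflTransGen.refl, he⟩
      · rcases h2 z hz with h | ⟨z', h, h'⟩
        · exact Or.inl (Relation.ReflTransGen.head hstep h)
        · exact Or.inr ⟨z', Relation.ReflTransGen.head hstep h, h'⟩
    · intro a
      rw [pathEdges_of_step hE hstep he, SimpleGraph.Walk.edges_cons, SimpleGraph.Walk.edges_cons,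
        List.mem_cons, List.mem_cons, h3, Sym2.eq_swap (a := HVertex.edge e)]
      simp [or_assoc]

theorem sameKind_of_mem_support {u w x y : G.HVertex} {P : G.dualRefinement.Walk u w}
    (hP : OnFrame P ∨ OnDualFrame P) (hx : SameKind x x) (hy : SameKind y y)
    (hxP : x ∈ P.support) (hyP : y ∈ P.support) : SameKind x y := by
  cases x <;> cases y <;> rcases hP with hP | hP <;>
    first
    | exact trivial
    | exact False.elim hx
    | exact False.elim hy
    | exact absurd hxP (hP _)
    | exact absurd hyP (hP _)

/-- A path that alternates between the edges of two matchings is forced to follow the steps of the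
first one. -/
theorem follows_of_isPath {S' U : Set _}
    (hE : IsPerfectMatchingOff G.dualRefinement B.plusDeleted E)
    (hE' : IsPerfectMatchingOff G.dualRefinement S' (E ∆ U)) {k : Fin (2 * n)} (hk : Odd (k : ℕ))
    (m : ℕ) : ∀ {x p : G.HVertex} (Q : G.dualRefinement.Walk x (B.mid k)), Q.length = m →
      SameKind x x → Q.IsPath → (∀ z ∈ Q.support, z ∉ B.evenVertices) →
      (OnFrame Q ∨ OnDualFrame Q) → (∀ a ∈ Q.edges, a ∈ U) → s(x, p) ∈ U → s(x, p) ∉ E →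
      p ∉ Q.support →
      (∃ y, Relation.ReflTransGen (B.Step E) x y ∧ s(y, B.mid k) ∈ E) ∧
        ∀ a, a ∈ Q.edges ↔ a ∈ B.pathEdges E x := by
  induction m using Nat.strong_induction_on with
  | _ m ih =>
    intro x p Q hm hx hQ hev hkind hU hpU hpE hp
    cases Q with
    | nil => exact absurd hx not_sameKind_edge
    | @cons _ c _ hxc Q =>
      obtain ⟨e, rfl⟩ := exists_edge_of_adj hx hxc
      have hcE : s(x, .edge e) ∈ E := by
        by_contra hcE
        have h1 : s(x, p) ∈ E ∆ U := Or.inr ⟨hpU, hpE⟩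
        have h2 : s(x, HVertex.edge e) ∈ E ∆ U := Or.inr ⟨hU _ (by simp), hcE⟩
        rw [hE'.unique h1 h2] at hp
        simp at hp
      cases Q with
      | nil =>
        refine ⟨⟨x, Relation.ReflTransGen.refl, hcE⟩, fun a => ?_⟩
        rw [pathEdges_of_not_step hE (not_step hE hk hcE) hcE]
        simp [mid]
      | @cons _ x' _ hcx' Q =>
        have hx' := sameKind_of_adj hcx'
        rw [SimpleGraph.Walk.cons_isPath_iff, SimpleGraph.Walk.cons_isPath_iff] at hQ
        obtain ⟨⟨hQ1, hQ2⟩, hQ3⟩ := hQ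
        have hne : x' ≠ x := by
          rintro rfl
          simp at hQ3
        have hsame : SameKind x x' :=
          sameKind_of_mem_support hkind hx hx' (by simp) (by simp)
        have hstep : B.Step E x x' := ⟨e, hcE, hcx', hsame, hne, hev _ (by simp)⟩
        have hx'E : s(x', HVertex.edge e) ∉ E := fun h => hne (hE.unique' h hcE)
        obtain ⟨⟨y, h1, h2⟩, h3⟩ := ih Q.length (by simp at hm; omega) (p := .edge e) Q rfl hx' hQ1
          (fun z hz => hev z (by simp [hz]))
          (hkind.imp (fun h f hf => h f (by simp [hf])) (fun h f hf => h f (by simp [hf])))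
          (fun a ha => hU a (by simp [ha])) (hU _ (by simp [Sym2.eq_swap])) hx'E hQ2
        refine ⟨⟨y, Relation.ReflTransGen.head hstep h1, h2⟩, fun a => ?_⟩
        rw [pathEdges_of_step hE hstep hcE, SimpleGraph.Walk.edges_cons,
          SimpleGraph.Walk.edges_cons, List.mem_cons, List.mem_cons, h3,
          Sym2.eq_swap (a := HVertex.edge e)]
        simp [or_assoc]

end BoundaryPath
end PlaneGraph

/-! ### Shifting a matching -/

namespace PlaneGraph

variable {V : Type*} {G : PlaneGraph V}

namespace BoundaryPath

variable {n : ℕ} {B : G.BoundaryPath n} {E : Set (Sym2 G.HVertex)}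

/-- Steps that start next to the edge-vertices deleted in `G⁺` and lead to the ends, bijectively,
give a family of paths along which the matching can be shifted. -/
theorem exists_isEdgeShift (hE : IsPerfectMatchingOff G.dualRefinement B.plusDeleted E)
    {τ : Equiv.Perm (Fin n)} {x y : Fin n → G.HVertex}
    (hx : ∀ i : Fin n, G.dualRefinement.Adj (B.mid ⟨2 * i, by omega⟩) (x i))
    (hxe : ∀ i, x i ∉ B.evenVertices)
    (hy : ∀ k : Fin n, s(y k, B.mid ⟨2 * k + 1, by omega⟩) ∈ E)
    (hr : ∀ i, Relation.ReflTransGen (B.Step E) (x i) (y (τ i))) :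
    ∃ E', IsPerfectMatchingOff G.dualRefinement B.minusDeleted E' ∧ B.IsEdgeShift E E' := by
  have hU := step_rightUnique (B := B) hE
  have hyend : ∀ k z, ¬ B.Step E (y k) z := fun k z => not_step hE ⟨k, rfl⟩ (hy k) z
  have hxx : ∀ i, SameKind (x i) (x i) := fun i => sameKind_of_adj (hx i)
  have hmid : ∀ i : Fin n, B.mid ⟨2 * i, by omega⟩ ∈ B.plusDeleted := fun i =>
    Or.inr ⟨_, even_two_mul (i : ℕ), rfl⟩
  have hto : ∀ {i z}, Relation.ReflTransGen (B.Step E) (x i) z →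
      Relation.ReflTransGen (B.Step E) z (y (τ i)) := by
    intro i z hz
    rcases Relation.ReflTransGen.total_of_right_unique hU hz (hr i) with h | h
    · exact h
    · rcases Relation.ReflTransGen.cases_head h with h | ⟨w, hw, -⟩
      · rw [h]
      · exact absurd hw (hyend _ _)
  have hyinj : Function.Injective y := by
    intro k k' h
    have h1 := hy k
    rw [h] at h1
    have h2 := congrArg Fin.val (B.mid_injective (hE.unique h1 (hy k')))
    simp only at h2
    exact Fin.ext (by omega)
  have hdisj : ∀ {i j z}, Relation.ReflTransGen (B.Step E) (x i) z →
      Relation.ReflTransGen (B.Step E) (x j) z → i = j := by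
    intro i j z hi hj
    apply τ.injective
    apply hyinj
    rcases Relation.ReflTransGen.total_of_right_unique hU (hto hi) (hto hj) with h | h <;>
      rcases Relation.ReflTransGen.cases_head h with h | ⟨w, hw, -⟩
    · exact h
    · exact absurd hw (hyend _ _)
    · exact h.symm
    · exact absurd hw (hyend _ _)
  have hcyc : ∀ {i z}, Relation.ReflTransGen (B.Step E) (x i) z →
      ¬ Relation.TransGen (B.Step E) z z := fun hz =>
    not_transGen_self hU (hyend _) (hto hz)
  have hkind : ∀ {i z}, Relation.ReflTransGen (B.Step E) (x i) z → SameKind z z := by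
    intro i z hz
    have := sameKind_of_reflTransGen (hxx i) hz
    exact this.symm.trans this
  have hev : ∀ {i z}, Relation.ReflTransGen (B.Step E) (x i) z → z ∉ B.evenVertices := by
    intro i z hz
    cases hz with
    | refl => exact hxe i
    | tail _ h => exact h.notMem
  choose Q hQ1 hQ2 hQ3 using fun i =>
    exists_path hE (hxx i) (hr i) (hyend (τ i)) (hy (τ i))
  have hstart : ∀ i, B.mid ⟨2 * i, by omega⟩ ∉ (Q i).support := by
    intro i h
    rcases hQ2 i _ h with h | ⟨z, -, h⟩
    · exact not_sameKind_edge (hkind h)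
    · exact hE.notMem' h (hmid i)
  let P : ∀ i : Fin n, G.dualRefinement.Walk
      (B.mid ⟨2 * i, by omega⟩) (B.mid ⟨2 * τ i + 1, by omega⟩) := fun i => .cons (hx i) (Q i)
  have hPsupp : ∀ {i z}, z ∈ (P i).support → z = B.mid ⟨2 * i, by omega⟩ ∨
      Relation.ReflTransGen (B.Step E) (x i) z ∨
        ∃ z', Relation.ReflTransGen (B.Step E) (x i) z' ∧ s(z', z) ∈ E := by
    intro i z hz
    rw [SimpleGraph.Walk.support_cons, List.mem_cons] at hz
    exact hz.imp_right (hQ2 i z)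
  let U : Set (Sym2 G.HVertex) := {e | ∃ i, e ∈ (P i).edges}
  have hmemU : ∀ {z c}, SameKind z z → (s(z, c) ∈ U ↔ ∃ i,
      (z = x i ∧ c = B.mid ⟨2 * i, by omega⟩) ∨
      (Relation.ReflTransGen (B.Step E) (x i) z ∧ s(z, c) ∈ E) ∨
        ∃ z', Relation.ReflTransGen (B.Step E) (x i) z' ∧ B.Step E z' z ∧ s(z', c) ∈ E) := by
    intro z c hz
    refine exists_congr fun i => ?_
    rw [SimpleGraph.Walk.edges_cons, List.mem_cons, hQ3, mem_pathEdges_iff hE (hxx i) hz,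
      Sym2.eq_iff]
    refine or_congr ⟨?_, fun h => Or.inr h⟩ Iff.rfl
    rintro (⟨rfl, -⟩ | h)
    · exact absurd hz not_sameKind_edge
    · exact h
  -- the shifted matching, seen from the vertices other than edge-vertices
  have hmem : ∀ {z c}, SameKind z z → (s(z, c) ∈ E ∆ U ↔
      (s(z, c) ∈ E ∧ ∀ i, ¬ Relation.ReflTransGen (B.Step E) (x i) z) ∨
      (∃ i, z = x i ∧ c = B.mid ⟨2 * i, by omega⟩) ∨
      ∃ i z', Relation.ReflTransGen (B.Step E) (x i) z' ∧ B.Step E z' z ∧ s(z', c) ∈ E) := by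
    intro z c hz
    rw [Set.mem_symmDiff, hmemU hz]
    constructor
    · rintro (⟨h1, h2⟩ | ⟨⟨i, h1 | h1 | h1⟩, h2⟩)
      · exact Or.inl ⟨h1, fun i h => h2 ⟨i, Or.inr (Or.inl ⟨h, h1⟩)⟩⟩
      · exact Or.inr (Or.inl ⟨i, h1⟩)
      · exact absurd h1.2 h2
      · exact Or.inr (Or.inr ⟨i, h1⟩)
    · rintro (⟨h1, h2⟩ | ⟨i, h1, rfl⟩ | ⟨i, z', h1, h2, h3⟩)
      · refine Or.inl ⟨h1, ?_⟩
        rintro ⟨i, ⟨-, rfl⟩ | ⟨h3, -⟩ | ⟨z', -, h3, h4⟩⟩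
        · exact hE.notMem' h1 (hmid i)
        · exact h2 i h3
        · exact h3.ne (hE.unique' h1 h4)
      · exact Or.inr ⟨⟨i, Or.inl ⟨h1, rfl⟩⟩, fun h => hE.notMem' h (hmid i)⟩
      · exact Or.inr ⟨⟨i, Or.inr (Or.inr ⟨z', h1, h2, h3⟩)⟩, fun h => h2.ne (hE.unique' h h3)⟩
  have hnotMid : ∀ {z k}, SameKind z z → z ≠ B.mid k := by
    rintro z k hz rfl
    exact not_sameKind_edge hz
  have hadj : ∀ {z c}, s(z, c) ∈ E ∆ U → G.dualRefinement.Adj z c := by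
    rintro z c (⟨h, -⟩ | ⟨⟨i, h⟩, -⟩)
    · exact hE.adj h
    · exact (P i).adj_of_mem_edges h
  refine ⟨E ∆ U, ⟨hadj, ?_, ?_, ?_⟩, τ, P, fun i => ?_, fun i z hz => ?_, fun i => ?_,
    fun i j hij z hi hj => ?_, rfl⟩
  · intro z c h
    rcases sameKind_self_or z with hz | ⟨e, rfl⟩
    · have hze : z ∉ B.evenVertices := by
        rcases (hmem hz).1 h with ⟨h, -⟩ | ⟨i, rfl, -⟩ | ⟨i, z', -, h, -⟩
        · exact fun h' => hE.notMem h (Or.inl h')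
        · exact hxe i
        · exact h.notMem
      rintro (h' | ⟨k, -, h'⟩)
      · exact hze h'
      · exact hnotMid hz h'
    · have hc := sameKind_of_adj (hadj h)
      rw [Sym2.eq_swap] at h
      rintro (h' | ⟨k, hk, h'⟩)
      · exact B.edge_notMem_evenVertices e h'
      · rw [h'] at h
        obtain ⟨j, hj⟩ := hk
        have hk2 := k.2
        obtain ⟨i, hi⟩ := τ.surjective ⟨j, by omega⟩
        have hyk : s(y (τ i), B.mid k) ∈ E := by
          rw [hi]
          convert hy ⟨j, by omega⟩ using 3
          exact Fin.ext hj
        rcases (hmem hc).1 h with ⟨h, h1⟩ | ⟨i, -, h1⟩ | ⟨i, z', -, h1, h2⟩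
        · rw [hE.unique' h hyk] at h1
          exact h1 i (hr i)
        · have := congrArg Fin.val (B.mid_injective h1)
          simp only at this
          omega
        · exact not_step hE ⟨j, hj⟩ h2 _ h1
  · intro z hz
    rcases sameKind_self_or z with hzz | ⟨e, rfl⟩
    · by_cases h : ∃ i, Relation.ReflTransGen (B.Step E) (x i) z
      · obtain ⟨i, h⟩ := h
        cases h with
        | refl => exact ⟨_, (hmem hzz).2 (Or.inr (Or.inl ⟨i, rfl, rfl⟩))⟩
        | @tail z' _ h h' =>
          have h2 := h'
          obtain ⟨e, he, -⟩ := h'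
          exact ⟨_, (hmem hzz).2 (Or.inr (Or.inr ⟨i, z', h, h2, he⟩))⟩
      · have hzS : z ∉ B.plusDeleted := by
          rintro (h' | ⟨k, -, h'⟩)
          · exact hz (Or.inl h')
          · exact hnotMid hzz h'
        obtain ⟨c, hc⟩ := hE.exists_mem hzS
        exact ⟨c, (hmem hzz).2 (Or.inl ⟨hc, fun i hi => h ⟨i, hi⟩⟩)⟩
    · by_cases hS : HVertex.edge e ∈ B.plusDeleted
      · rcases hS with hS | ⟨k, ⟨j, hj⟩, hS⟩
        · exact absurd hS (B.edge_notMem_evenVertices e)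
        · have hk2 := k.2
          refine ⟨x ⟨j, by omega⟩, ?_⟩
          rw [Sym2.eq_swap, hmem (hxx _), hS]
          refine Or.inr (Or.inl ⟨_, rfl, ?_⟩)
          congr 1
          ext
          simp
          omega
      · obtain ⟨z, hzE⟩ := hE.exists_mem hS
        have hzz := sameKind_of_adj (hE.adj hzE)
        rw [Sym2.eq_swap] at hzE
        by_cases h : ∃ i, Relation.ReflTransGen (B.Step E) (x i) z
        · obtain ⟨i, h⟩ := h
          rcases Relation.ReflTransGen.cases_head (hto h) with h1 | ⟨w, hw, -⟩
          · rw [h1] at hzE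
            exact absurd (Or.inr ⟨_, ⟨_, rfl⟩, hE.unique hzE (hy _)⟩) hz
          · refine ⟨w, ?_⟩
            rw [Sym2.eq_swap, hmem (hw.sameKind.symm.trans hw.sameKind)]
            exact Or.inr (Or.inr ⟨i, z, h, hw, hzE⟩)
        · refine ⟨z, ?_⟩
          rw [Sym2.eq_swap, hmem hzz]
          exact Or.inl ⟨hzE, fun i hi => h ⟨i, hi⟩⟩
  · intro z c c' h h'
    rcases sameKind_self_or z with hz | ⟨e, rfl⟩
    · rcases (hmem hz).1 h with ⟨h1, h2⟩ | ⟨i, h1, rfl⟩ | ⟨i, w, h1, h2, h3⟩ <;>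
        rcases (hmem hz).1 h' with ⟨h1', h2'⟩ | ⟨j, h1', rfl⟩ | ⟨j, w', h1', h2', h3'⟩
      · exact hE.unique h1 h1'
      · exact absurd (h1' ▸ Relation.ReflTransGen.refl) (h2 j)
      · exact absurd (h1'.tail h2') (h2 j)
      · exact absurd (h1 ▸ Relation.ReflTransGen.refl) (h2' i)
      · obtain rfl : i = j := hdisj (z := z) (h1 ▸ Relation.ReflTransGen.refl)
          (h1' ▸ Relation.ReflTransGen.refl)
        rfl
      · obtain rfl : i = j := hdisj (z := z) (h1 ▸ Relation.ReflTransGen.refl) (h1'.tail h2')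
        rw [h1] at h2'
        exact absurd (Relation.TransGen.tail' h1' h2') (hcyc Relation.ReflTransGen.refl)
      · exact absurd (h1.tail h2) (h2' i)
      · obtain rfl : i = j := hdisj (z := z) (h1.tail h2) (h1' ▸ Relation.ReflTransGen.refl)
        rw [h1'] at h2
        exact absurd (Relation.TransGen.tail' h1 h2) (hcyc Relation.ReflTransGen.refl)
      · obtain rfl : i = j := hdisj (h1.tail h2) (h1'.tail h2')
        have hww : w = w' := by
          have key : ∀ {w w'}, Relation.ReflTransGen (B.Step E) w w' → B.Step E w z →
              B.Step E w' z → w = w' := by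
            intro w w' hw h2 h2'
            rcases Relation.ReflTransGen.cases_head hw with hw | ⟨u, hu, hw⟩
            · exact hw
            · rw [hU hu h2] at hw
              exact absurd (Relation.TransGen.tail' hw h2') (hcyc (h1.tail ‹B.Step E _ z›))
          rcases Relation.ReflTransGen.total_of_right_unique hU h1 h1' with hw | hw
          · exact key hw h2 h2'
          · exact (key hw h2' h2).symm
        rw [hww] at h3
        exact hE.unique h3 h3'
    · have hc := sameKind_of_adj (hadj h)
      have hc' := sameKind_of_adj (hadj h')
      rw [Sym2.eq_swap] at h h'
      rcases (hmem hc).1 h with ⟨h1, h2⟩ | ⟨i, rfl, h1⟩ | ⟨i, w, h1, h2, h3⟩ <;>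
        rcases (hmem hc').1 h' with ⟨h1', h2'⟩ | ⟨j, rfl, h1'⟩ | ⟨j, w', h1', h2', h3'⟩
      · exact hE.unique' h1 h1'
      · exact absurd (h1' ▸ hmid j) (hE.notMem' h1)
      · exact absurd (hE.unique' h3' h1 ▸ h1') (h2 j)
      · exact absurd (h1 ▸ hmid i) (hE.notMem' h1')
      · have := congrArg Fin.val (B.mid_injective (h1.symm.trans h1'))
        simp only at this
        rw [show i = j from Fin.ext (by omega)]
      · exact absurd (h1 ▸ hmid i) (hE.notMem' h3')
      · exact absurd (hE.unique' h3 h1' ▸ h1) (h2' i)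
      · exact absurd (h1' ▸ hmid j) (hE.notMem' h3)
      · rw [hE.unique' h3 h3'] at h2
        exact hU h2 h2'
  · exact (SimpleGraph.Walk.cons_isPath_iff _ _).2 ⟨hQ1 i, hstart i⟩
  · rcases hPsupp hz with rfl | hz | ⟨w, hw, hz⟩
    · exact B.mid_notMem_evenVertices _
    · exact hev hz
    · obtain ⟨e, rfl⟩ := exists_edge_of_adj (hkind hw) (hE.adj hz)
      exact B.edge_notMem_evenVertices e
  · have h1 : ∀ z ∈ (P i).support, SameKind z z → SameKind (x i) z := by
      intro z hz hzz
      rcases hPsupp hz with rfl | hz | ⟨w, hw, hz⟩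
      · exact absurd hzz not_sameKind_edge
      · exact sameKind_of_reflTransGen (hxx i) hz
      · obtain ⟨e, rfl⟩ := exists_edge_of_adj (hkind hw) (hE.adj hz)
        exact absurd hzz not_sameKind_edge
    have h2 := hxx i
    generalize x i = u at h1 h2
    cases u with
    | orig v => exact Or.inl fun f hf => h1 _ hf trivial
    | face f => exact Or.inr fun v hv => h1 _ hv trivial
    | edge e => exact False.elim h2
  · rcases hPsupp hi with rfl | hi | ⟨w, hw, hi⟩ <;>
      rcases hPsupp hj with hj | hj | ⟨w', hw', hj⟩
    · have := congrArg Fin.val (B.mid_injective hj)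
      simp only at this
      exact hij (Fin.ext (by omega))
    · exact not_sameKind_edge (hkind hj)
    · exact hE.notMem' hj (hmid i)
    · exact hnotMid (hkind hi) hj
    · exact hij (hdisj hi hj)
    · obtain ⟨e, rfl⟩ := exists_edge_of_adj (hkind hw') (hE.adj hj)
      exact not_sameKind_edge (hkind hi)
    · rw [hj] at hi
      exact hE.notMem' hi (hmid j)
    · obtain ⟨e, rfl⟩ := exists_edge_of_adj (hkind hw) (hE.adj hi)
      exact not_sameKind_edge (hkind hj)
    · rw [hE.unique' hi hj] at hw
      exact hij (hdisj hw hw')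

end BoundaryPath
end PlaneGraph

/-! ### The choice of the paths -/

namespace PlaneGraph

variable {V : Type*} {G : PlaneGraph V}

open Classical in
/-- The face-vertex of a bounded face, and `none` for the unbounded face. -/
noncomputable def faceVertex (f : G.Face) : Option G.HVertex :=
  if h : f = G.outerFace then none else some (.face ⟨f, h⟩)

theorem faceVertex_outer : faceVertex G.outerFace = none := dif_pos rfl

theorem faceVertex_of_ne {f : G.Face} (h : f ≠ G.outerFace) :
    faceVertex f = some (.face ⟨f, h⟩) := dif_neg h

namespace BoundaryPath

variable {n : ℕ} {B : G.BoundaryPath n} {E : Set (Sym2 G.HVertex)}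

/-- An edge-vertex deleted in `G⁺` has at most two neighbors that are not deleted: the odd vertex of
its edge, and the face next to it if this one is bounded. -/
theorem some_eq_iff_of_even {k : Fin (2 * n)} (hk : Even (k : ℕ)) (x : G.HVertex) :
    (some x = some (.orig (B.vert k.succ)) ∨ some x = faceVertex (B.innerFace k)) ↔
      G.dualRefinement.Adj (B.mid k) x ∧ x ∉ B.evenVertices := by
  have hodd : ¬ Even (k.succ : ℕ) := by
    rw [Fin.val_succ]
    exact Nat.not_even_iff_odd.2 hk.add_one
  cases x with
  | orig v =>
    rw [mid_adj_orig]
    constructor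
    · rintro (h | h)
      · cases h
        exact ⟨Or.inr rfl, fun h => hodd ((B.orig_mem_evenVertices _).1 h)⟩
      · unfold faceVertex at h
        split_ifs at h
        cases h
    · rintro ⟨rfl | rfl, h⟩
      · exact absurd ((B.orig_mem_evenVertices _).2 hk) h
      · exact Or.inl rfl
  | face f =>
    rw [mid_adj_face]
    constructor
    · rintro (h | h)
      · cases h
      · unfold faceVertex at h
        split_ifs at h
        cases h
        exact ⟨rfl, B.face_notMem_evenVertices _⟩
    · rintro ⟨h, -⟩
      right
      rw [← h, faceVertex_of_ne f.2]
  | edge e =>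
    constructor
    · rintro (h | h)
      · cases h
      · unfold faceVertex at h
        split_ifs at h
        cases h
    · exact fun h => absurd (sameKind_of_adj h.1) not_sameKind_edge

/-- Sets of classes of steps that contain, with one neighbor of a deleted edge-vertex of `G⁺`, also
the other one, but do not contain the unbounded face, contain no ends. -/
theorem EvenDegrees.notMem_of_quot [Finite V] (hB : B.EvenDegrees)
    (hE : IsPerfectMatchingOff G.dualRefinement B.plusDeleted E) {K : Set (Quot (B.StepOut E))}
    (hout : Quot.mk _ none ∉ K)
    (hlink : ∀ k : Fin (2 * n), Even (k : ℕ) →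
      (Quot.mk _ (some (.orig (B.vert k.succ))) ∈ K ↔ Quot.mk _ (faceVertex (B.innerFace k)) ∈ K))
    {k : Fin (2 * n)} (hk : Odd (k : ℕ)) {y : G.HVertex} (hy : s(y, B.mid k) ∈ E) :
    Quot.mk _ (some y) ∉ K := by
  have key := hB.notMem_of_invariant 
    (K := {v : V | Quot.mk (B.StepOut E) (some (HVertex.orig v)) ∈ K})
    (L := {f | Quot.mk _ (faceVertex f) ∈ K}) (by rwa [Set.mem_ofPred_eq, faceVertex_outer])
    (fun d hd => ?_) (fun k hk => (hlink k hk).symm) k hk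
  · have hadj := (hE.adj hy).symm
    cases y with
    | orig v =>
      rw [mid_adj_orig] at hadj
      rcases hadj with rfl | rfl
      · exact key.1
      · refine absurd (Or.inl ((B.orig_mem_evenVertices _).2 ?_)) (hE.notMem hy)
        rw [Fin.val_succ]
        exact hk.add_one
    | face f =>
      rw [mid_adj_face] at hadj
      have := key.2
      rwa [Set.mem_ofPred_eq, ← hadj, faceVertex_of_ne f.2] at this
    | edge e => exact absurd (sameKind_of_adj hadj) not_sameKind_edge
  · let e : G.graph.edgeSet := ⟨d.edge, d.edge_mem⟩
    have heS : HVertex.edge e ∉ B.plusDeleted := by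
      rintro (h | ⟨k, -, h⟩)
      · exact B.edge_notMem_evenVertices _ h
      · rw [mid_eq, HVertex.edge.injEq] at h
        exact hd k (congrArg Subtype.val h)
    obtain ⟨x, hx⟩ := hE.exists_mem heS
    have hadj := hE.adj hx
    rw [Sym2.eq_swap] at hx
    cases x with
    | orig v =>
      left
      have hev : ∀ d' : G.graph.Dart, d'.edge = d.edge → HVertex.orig d'.fst ∉ B.evenVertices := by
        rintro d' hd' ⟨k, hk, h⟩
        rw [HVertex.orig.injEq] at h
        obtain ⟨j, hj⟩ := hB.exists_edge_eq d' k hk h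
        exact hd j (hd'.symm.trans hj)
      have hs : ∀ d' : G.graph.Dart, d'.edge = d.edge → v = d'.fst →
          Quot.mk (B.StepOut E) (some (.orig d'.fst)) = Quot.mk _ (some (.orig d'.snd)) := by
        rintro d' hd' rfl
        refine Quot.sound (StepOut.step ⟨e, hx, adj_edge_orig.2 ?_, trivial, ?_, ?_⟩)
        · change d'.snd ∈ d.edge
          rw [← hd']
          exact Sym2.mem_mk_right _ _
        · intro h
          rw [HVertex.orig.injEq] at h
          exact d'.fst_ne_snd h.symm
        · exact hev d'.symm (d'.edge_symm.trans hd')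
      rw [adj_edge_orig] at hadj
      rcases Sym2.mem_iff.1 (show v ∈ s(d.fst, d.snd) from hadj) with h | h
      · rw [Set.mem_ofPred_eq, Set.mem_ofPred_eq, hs d rfl h]
      · rw [Set.mem_ofPred_eq, Set.mem_ofPred_eq]
        exact Eq.to_iff (congrArg (· ∈ K) (hs d.symm d.edge_symm h).symm)
    | face f =>
      right
      have hs : ∀ d' : G.graph.Dart, d'.edge = d.edge → f.1 = G.leftFace d' →
          Quot.mk (B.StepOut E) (faceVertex (G.leftFace d')) =
            Quot.mk _ (faceVertex (G.leftFace d'.symm)) := by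
        intro d' hd' h
        by_cases h1 : G.leftFace d'.symm = G.leftFace d'
        · rw [h1]
        · have h2 : G.EdgeOnFace d.edge (G.leftFace d'.symm) :=
            ⟨d'.symm, d'.edge_symm.trans hd', rfl⟩
          rw [← h, faceVertex_of_ne f.2]
          by_cases h3 : G.leftFace d'.symm = G.outerFace
          · rw [h3, faceVertex_outer]
            exact Quot.sound (StepOut.out hx hd (h3 ▸ h2))
          · rw [faceVertex_of_ne h3]
            refine Quot.sound (StepOut.step ⟨e, hx, adj_edge_face.2 h2, trivial, fun h4 => h1 ?_,
              B.face_notMem_evenVertices _⟩)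
            rw [HVertex.face.injEq, Subtype.ext_iff] at h4
            exact h4.trans h
      rw [adj_edge_face, edgeOnFace_iff] at hadj
      rcases hadj with h | h
      · rw [Set.mem_ofPred_eq, Set.mem_ofPred_eq, hs d rfl h]
      · have := hs d.symm d.edge_symm h
        rw [SimpleGraph.Dart.symm_symm] at this
        rw [Set.mem_ofPred_eq, Set.mem_ofPred_eq, this]
    | edge e' => exact absurd (sameKind_of_adj hadj) not_sameKind_edge

/-- A perfect matching of `G⁺` can be shifted in exactly one way. -/
theorem EvenDegrees.existsUnique_isEdgeShift [Finite V] (hB : B.EvenDegrees)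
    (hE : IsPerfectMatchingOff G.dualRefinement B.plusDeleted E) :
    ∃! E', IsPerfectMatchingOff G.dualRefinement B.minusDeleted E' ∧ B.IsEdgeShift E E' := by
  have hyex : ∀ k : Fin n, ∃ y, s(y, B.mid ⟨2 * k + 1, by omega⟩) ∈ E := by
    intro k
    have hS : B.mid ⟨2 * k + 1, by omega⟩ ∉ B.plusDeleted := by
      rintro (h | ⟨j, ⟨i, hi⟩, h⟩)
      · exact B.mid_notMem_evenVertices _ h
      · have := congrArg Fin.val (B.mid_injective h)
        simp only at this
        omega
    obtain ⟨y, hy⟩ := hE.exists_mem hS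
    exact ⟨y, Sym2.eq_swap ▸ hy⟩
  choose y hy using hyex
  have hyend : ∀ k z, ¬ B.StepOut E (some (y k)) z := fun k => not_stepOut hE ⟨k, rfl⟩ (hy k)
  have hU := stepOut_rightUnique (B := B) hE
  let mk : Option G.HVertex → Quot (B.StepOut E) := Quot.mk _
  -- each deleted edge-vertex links the classes of its two neighbors left in `G⁺`
  let a : Fin n → Quot (B.StepOut E) := fun i =>
    mk (some (.orig (B.vert (⟨2 * i, by omega⟩ : Fin (2 * n)).succ)))
  let b : Fin n → Quot (B.StepOut E) := fun i => mk (faceVertex (B.innerFace ⟨2 * i, by omega⟩))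
  let t : Fin n → Quot (B.StepOut E) := fun k => mk (some (y k))
  have hst : ∀ {x k}, mk (some x) = t k ↔ Relation.ReflTransGen (B.Step E) x (y k) := by
    intro x k
    constructor
    · exact fun h => reflTransGen_step_of_stepOut (reflTransGen_of_quot_eq hU (hyend k) h)
    · intro h
      induction h using Relation.ReflTransGen.head_induction_on with
      | refl => rfl
      | head h _ ih => exact (Quot.sound (StepOut.step h)).trans ih
  have htinj : Function.Injective t := by
    intro k k' h
    have h1 : y k = y k' := by
      rcases Relation.ReflTransGen.cases_head (hst.1 h) with h | ⟨w, hw, -⟩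
      · exact h
      · exact absurd (StepOut.step hw) (hyend _ _)
    have h2 := hy k
    rw [h1] at h2
    have h3 := congrArg Fin.val (B.mid_injective (hE.unique h2 (hy k')))
    simp only at h3
    exact Fin.ext (by omega)
  have htnone : ∀ k, t k ≠ mk none := by
    intro k h
    rcases Relation.ReflTransGen.cases_head (reflTransGen_of_quot_eq hU (hyend k) h.symm) with
      h | ⟨w, hw, -⟩
    · cases h
    · cases hw
  obtain ⟨τ, hτ, hτuniq⟩ := existsUnique_perm_of_connected a b t (mk none) htinj htnone
    fun K hK hab k => hB.notMem_of_quot hE hK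
      (fun j hj => by
        obtain ⟨i, hi⟩ := hj
        have hj2 := j.2
        have h := hab ⟨i, by omega⟩
        have hji : j = ⟨2 * i, by omega⟩ := Fin.ext (by simp; omega)
        rw [hji]
        exact h) ⟨k, rfl⟩ (hy k)
  have hcand : ∀ (i : Fin n) (x : G.HVertex),
      (some x = some (.orig (B.vert (⟨2 * i, by omega⟩ : Fin (2 * n)).succ)) ∨
        some x = faceVertex (B.innerFace ⟨2 * i, by omega⟩)) ↔
      G.dualRefinement.Adj (B.mid ⟨2 * i, by omega⟩) x ∧ x ∉ B.evenVertices := fun i x =>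
    some_eq_iff_of_even (even_two_mul (i : ℕ)) x
  have hxex : ∀ i : Fin n, ∃ x, (G.dualRefinement.Adj (B.mid ⟨2 * i, by omega⟩) x ∧
      x ∉ B.evenVertices) ∧ Relation.ReflTransGen (B.Step E) x (y (τ i)) := by
    intro i
    rcases hτ i with h | h
    · exact ⟨_, (hcand i _).1 (Or.inl rfl), hst.1 h.symm⟩
    · cases hf : faceVertex (B.innerFace ⟨2 * i, by omega⟩) with
      | none =>
        refine absurd (h.trans ?_) (htnone (τ i))
        exact congrArg mk hf
      | some x => exact ⟨x, (hcand i x).1 (Or.inr hf.symm), hst.1 (by rw [h, ← hf])⟩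
  choose x hx hr using hxex
  obtain ⟨E', hE', hEE'⟩ := exists_isEdgeShift hE (fun i => (hx i).1) (fun i => (hx i).2) hy hr
  -- the edges of the paths of any shift
  have huniq : ∀ E'', IsPerfectMatchingOff G.dualRefinement B.minusDeleted E'' →
      B.IsEdgeShift E E'' → E'' = E ∆ {c | ∃ i : Fin n,
        c = s(B.mid ⟨2 * i, by omega⟩, x i) ∨ c ∈ B.pathEdges E (x i)} := by
    rintro E'' hE'' ⟨τ', P, hP1, hP2, hP3, -, rfl⟩
    have key : ∀ i : Fin n, ∃ x', (G.dualRefinement.Adj (B.mid ⟨2 * i, by omega⟩) x' ∧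
        x' ∉ B.evenVertices) ∧ Relation.ReflTransGen (B.Step E) x' (y (τ' i)) ∧
        ∀ c, c ∈ (P i).edges ↔ c = s(B.mid ⟨2 * i, by omega⟩, x') ∨ c ∈ B.pathEdges E x' := by
      intro i
      have hne : B.mid ⟨2 * i, by omega⟩ ≠ B.mid ⟨2 * τ' i + 1, by omega⟩ := by
        intro h
        have := congrArg Fin.val (B.mid_injective h)
        simp only at this
        omega
      obtain ⟨x', hadj, q, hq0⟩ := SimpleGraph.Walk.exists_eq_cons_of_ne hne (P i)
      have hUi : ∀ c ∈ (P i).edges, c ∈ {c | ∃ i, c ∈ (P i).edges} := fun c hc => ⟨i, hc⟩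
      have h1 := hP1 i
      have h2 := hP2 i
      have h3 := hP3 i
      rw [hq0] at h1 h2 h3 hUi ⊢
      have hxx := sameKind_of_adj hadj
      rw [SimpleGraph.Walk.cons_isPath_iff] at h1
      obtain ⟨⟨z, hz1, hz2⟩, hq⟩ := follows_of_isPath hE hE'' ⟨(τ' i : ℕ), rfl⟩ q.length q rfl hxx
        h1.1 (fun z hz => h2 z (by simp [hz]))
        (h3.imp (fun h f hf => h f (by simp [hf])) (fun h f hf => h f (by simp [hf])))
        (fun c hc => hUi c (by simp [hc])) (hUi _ (by simp [Sym2.eq_swap]))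
        (fun h => hE.notMem' h (Or.inr ⟨_, even_two_mul (i : ℕ), rfl⟩)) h1.2
      refine ⟨x', ⟨hadj, h2 x' (by simp)⟩, ?_, fun c => ?_⟩
      · rwa [← hE.unique' hz2 (hy _)]
      · rw [SimpleGraph.Walk.edges_cons, List.mem_cons, hq]
    choose x' hx' hr' hc' using key
    have hτ' : τ' = τ := by
      refine hτuniq τ' fun i => ?_
      rw [← hst.2 (hr' i)]
      exact ((hcand i (x' i)).2 (hx' i)).imp (congrArg mk) (congrArg mk)
    subst hτ'
    have hxx' : ∀ i : Fin n, x' i = x i := by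
      intro i
      have h1 := (hcand i (x' i)).2 (hx' i)
      have h2 := (hcand i (x i)).2 (hx i)
      have h3 := sameKind_of_reflTransGen (sameKind_of_adj (hx' i).1) (hr' i)
      have h4 := sameKind_of_reflTransGen (sameKind_of_adj (hx i).1) (hr i)
      have h5 := h3.trans h4.symm
      rw [← Option.some_inj]
      have hne : ∀ {u w}, some u = some (HVertex.orig w) →
          some u ≠ faceVertex (B.innerFace ⟨2 * i, by omega⟩) := by
        rintro u w h h'
        rw [h] at h'
        unfold faceVertex at h'
        split_ifs at h'
        cases h'
      have hkind : ∀ {u u' : G.HVertex} {w}, SameKind u u' → some u = some (HVertex.orig w) →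
          some u' ≠ faceVertex (B.innerFace ⟨2 * i, by omega⟩) := by
        intro u u' w h h' h''
        cases h'
        cases u' with
        | orig w' => exact hne rfl h''
        | face f => exact h
        | edge e => exact h
      rcases h1 with h1 | h1 <;> rcases h2 with h2 | h2
      · exact h1.trans h2.symm
      · exact absurd h2 (hkind h5 h1)
      · exact absurd h1 (hkind h5.symm h2)
      · exact h1.trans h2.symm
    simp only [hc', hxx']
  exact ⟨E', ⟨hE', hEE'⟩, fun E'' h => (huniq E'' h.1 h.2).trans (huniq E' hE' hEE').symm⟩

/-! ### Reversing the path -/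

/-- The path traversed from its other end. -/
def reverse (B : G.BoundaryPath n) : G.BoundaryPath n where
  vert k := B.vert k.rev
  injective := B.injective.comp Fin.rev_injective
  adj k := by
    rw [Fin.rev_castSucc, Fin.rev_succ]
    exact (B.adj k.rev).symm
  on_outer k := by
    rw [Fin.rev_castSucc, Fin.rev_succ, Sym2.eq_swap]
    exact B.on_outer k.rev

theorem reverse_mid (B : G.BoundaryPath n) (k : Fin (2 * n)) : B.reverse.mid k = B.mid k.rev := by
  refine congrArg HVertex.edge (Subtype.ext ?_)
  change s(B.vert k.castSucc.rev, B.vert k.succ.rev) = _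
  rw [Fin.rev_castSucc, Fin.rev_succ, Sym2.eq_swap]

theorem even_rev_iff (k : Fin (2 * n + 1)) : Even (k.rev : ℕ) ↔ Even (k : ℕ) := by
  have := k.2
  rw [Fin.val_rev, Nat.even_iff, Nat.even_iff]
  omega

theorem odd_rev_iff (k : Fin (2 * n)) : Odd (k.rev : ℕ) ↔ Even (k : ℕ) := by
  have := k.2
  rw [Fin.val_rev, Nat.odd_iff, Nat.even_iff]
  omega

theorem EvenDegrees.reverse (hB : B.EvenDegrees) : B.reverse.EvenDegrees where
  pos := hB.pos
  first := by
    change G.deg (B.vert (Fin.rev 0)) = 1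
    rw [Fin.rev_zero, hB.last]
  last := by
    change G.deg (B.vert (Fin.rev _)) = 1
    rw [Fin.rev_last, hB.first]
  even k hk h0 hl := by
    refine hB.even k.rev ((even_rev_iff k).2 hk) (fun h => hl ?_) (fun h => h0 ?_)
    · rw [← Fin.rev_rev k, h, Fin.rev_zero]
    · rw [← Fin.rev_rev k, h, Fin.rev_last]

theorem reverse_evenVertices (B : G.BoundaryPath n) : B.reverse.evenVertices = B.evenVertices := by
  ext x
  constructor
  · rintro ⟨k, hk, rfl⟩
    exact ⟨k.rev, (even_rev_iff k).2 hk, rfl⟩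
  · rintro ⟨k, hk, rfl⟩
    exact ⟨k.rev, (even_rev_iff k).2 hk, by simp [reverse]⟩

theorem reverse_plusDeleted (B : G.BoundaryPath n) : B.reverse.plusDeleted = B.minusDeleted := by
  rw [plusDeleted, minusDeleted, reverse_evenVertices]
  congr 1
  ext x
  constructor
  · rintro ⟨k, hk, rfl⟩
    exact ⟨k.rev, (odd_rev_iff k).2 hk, B.reverse_mid k⟩
  · rintro ⟨k, hk, rfl⟩
    refine ⟨k.rev, (odd_rev_iff _).1 (by rwa [Fin.rev_rev]), ?_⟩
    rw [reverse_mid, Fin.rev_rev]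

theorem reverse_reverse (B : G.BoundaryPath n) : B.reverse.reverse = B := by
  cases B
  simp [reverse]

theorem reverse_minusDeleted (B : G.BoundaryPath n) : B.reverse.minusDeleted = B.plusDeleted := by
  rw [← reverse_plusDeleted, reverse_reverse]

/-- Reversing the path and the walks turns a shift from `E` to `E'` into one from `E'` to `E`. -/
theorem IsEdgeShift.reverse {E E' : Set (Sym2 G.HVertex)} (h : B.IsEdgeShift E E') :
    B.reverse.IsEdgeShift E' E := by
  obtain ⟨τ, P, h1, h2, h3, h4, rfl⟩ := h
  -- the walk of the reversed family starting at `2i` is the reverse of the walk with index `σ i`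
  let σ : Equiv.Perm (Fin n) := Fin.revPerm.trans τ.symm
  have hs : ∀ i : Fin n, B.reverse.mid ⟨2 * i, by omega⟩ = B.mid ⟨2 * τ (σ i) + 1, by omega⟩ := by
    intro i
    rw [reverse_mid]
    congr 1
    ext
    simp [σ, Fin.val_rev]
    omega
  have he : ∀ i : Fin n, B.reverse.mid ⟨2 * (σ.trans Fin.revPerm i) + 1, by omega⟩ =
      B.mid ⟨2 * σ i, by omega⟩ := by
    intro i
    rw [reverse_mid]
    congr 1
    ext
    simp [Fin.val_rev]
    omega
  let Q : ∀ i : Fin n, G.dualRefinement.Walk (B.reverse.mid ⟨2 * i, by omega⟩)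
      (B.reverse.mid ⟨2 * (σ.trans Fin.revPerm i) + 1, by omega⟩) := fun i =>
    (P (σ i)).reverse.copy (hs i).symm (he i).symm
  have hsupp : ∀ {i z}, z ∈ (Q i).support → z ∈ (P (σ i)).support := by
    intro i z hz
    rwa [SimpleGraph.Walk.support_copy, SimpleGraph.Walk.support_reverse, List.mem_reverse] at hz
  have hedges : ∀ {i e}, e ∈ (Q i).edges ↔ e ∈ (P (σ i)).edges := by
    intro i e
    rw [SimpleGraph.Walk.edges_copy, SimpleGraph.Walk.edges_reverse, List.mem_reverse]
  refine ⟨σ.trans Fin.revPerm, Q, fun i => ?_, fun i z hz => ?_, fun i => ?_,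
    fun i j hij z hi hj => ?_, ?_⟩
  · rw [SimpleGraph.Walk.isPath_copy]
    exact (h1 _).reverse
  · rw [reverse_evenVertices]
    exact h2 (σ i) z (hsupp hz)
  · exact (h3 (σ i)).imp (fun h f hf => h f (hsupp hf)) fun h f hf => h f (hsupp hf)
  · exact h4 (σ i) (σ j) (fun h => hij (σ.injective h)) z (hsupp hi) (hsupp hj)
  · have : {e | ∃ i, e ∈ (Q i).edges} = {e | ∃ i, e ∈ (P i).edges} := by
      ext e
      exact (exists_congr fun i => hedges).trans
        (σ.surjective.exists (p := fun i => e ∈ (P i).edges)).symm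
    rw [this, symmDiff_symmDiff_cancel_right]

theorem EvenDegrees.existsUnique_isEdgeShift_left [Finite V] (hB : B.EvenDegrees)
    {E' : Set (Sym2 G.HVertex)}
    (hE' : IsPerfectMatchingOff G.dualRefinement B.minusDeleted E') :
    ∃! E, IsPerfectMatchingOff G.dualRefinement B.plusDeleted E ∧ B.IsEdgeShift E E' := by
  have h := hB.reverse.existsUnique_isEdgeShift (E := E') (by rwa [reverse_plusDeleted])
  rw [reverse_minusDeleted] at h
  obtain ⟨E, ⟨h1, h2⟩, h3⟩ := h
  refine ⟨E, ⟨h1, ?_⟩, fun E'' h4 => h3 E'' ⟨h4.1, h4.2.reverse⟩⟩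
  have := h2.reverse
  rwa [reverse_reverse] at this

/-- Shifting is a bijection, since both a matching and its shift determine the other one. -/
theorem EvenDegrees.exists_equiv [Finite V] (hB : B.EvenDegrees) :
    ∃ φ : PerfectMatchings B.plus ≃ PerfectMatchings B.minus, ∀ μ, B.IsShift μ (φ μ) := by
  have h1 : ∀ μ : PerfectMatchings B.plus, ∃ μ' : PerfectMatchings B.minus, B.IsShift μ μ' := by
    intro μ
    obtain ⟨E', ⟨hE', hs⟩, -⟩ := hB.existsUnique_isEdgeShift (isPerfectMatchingOff_matchingEdges μ)
    obtain ⟨μ', rfl⟩ := exists_matchingEdges_eq hE'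
    exact ⟨μ', hs⟩
  choose φ hφ using h1
  have hbij : Function.Bijective φ := by
    constructor
    · intro μ ν h
      have h2 := hB.existsUnique_isEdgeShift_left (isPerfectMatchingOff_matchingEdges (φ μ))
      have hν := hφ ν
      rw [← h] at hν
      exact matchingEdges_injective (h2.unique ⟨isPerfectMatchingOff_matchingEdges μ, hφ μ⟩
        ⟨isPerfectMatchingOff_matchingEdges ν, hν⟩)
    · intro μ'
      obtain ⟨E, ⟨hE, hs⟩, -⟩ :=
        hB.existsUnique_isEdgeShift_left (isPerfectMatchingOff_matchingEdges μ')
      obtain ⟨μ, rfl⟩ := exists_matchingEdges_eq hE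
      refine ⟨μ, matchingEdges_injective ?_⟩
      exact (hB.existsUnique_isEdgeShift (isPerfectMatchingOff_matchingEdges μ)).unique
        ⟨isPerfectMatchingOff_matchingEdges (φ μ), hφ μ⟩
        ⟨isPerfectMatchingOff_matchingEdges μ', hs⟩
  exact ⟨Equiv.ofBijective φ hbij, hφ⟩

end BoundaryPath
end PlaneGraph

theorem theorem2p1 {V : Type*} [Finite V] (G : PlaneGraph V) (hG : G.NoInnerLeaf)
    (n : ℕ) (hn : 1 ≤ n) (B : G.BoundaryPath n)
    (hfirst : G.deg (B.vert 0) = 1) (hlast : G.deg (B.vert (Fin.last (2 * n))) = 1)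
    (heven : ∀ k : Fin (2 * n + 1), Even (k : ℕ) → k ≠ 0 → k ≠ Fin.last (2 * n) →
      G.deg (B.vert k) = 2) :
    (∃ φ : PerfectMatchings B.plus ≃ PerfectMatchings B.minus, ∀ μ, B.IsShift μ (φ μ)) ∧
      numPerfectMatchings B.plus = numPerfectMatchings B.minus := by
  have hB : B.EvenDegrees := ⟨hn, hfirst, hlast, heven⟩
  obtain ⟨φ, hφ⟩ := hB.exists_equiv
  exact ⟨⟨φ, hφ⟩, Nat.card_congr φ⟩
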